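/- Let $N\ge 2$ be an integer and $E>0$. Let $\mathcal S_{N,E}=\{\boldsymbol\eta\in[0,\infty)^N:\ \frac1N\sum_{k=1}^N\eta_k=E\}$, let $\sigma_{N,E}$ be the uniform probability measure on $\mathcal S_{N,E}$, and write $\mathcal S_N=\mathcal S_{N,1}$, $\sigma_N=\sigma_{N,1}$. All functions are real-valued. For $i<j$ and $\alpha\in[0,1]$ let $\boldsymbol\eta^*_{i,j,\alpha}$ be obtained from $\boldsymbol\eta$ by replacing $\eta_i$ by $\alpha(\eta_i+\eta_j)$ and $\eta_j$ by $(1-\alpha)(\eta_i+\eta_j)$, and let $[f]^{(i,j)}(\boldsymbol\eta)=\int_0^1 f(\boldsymbol\eta^*_{i,j,\alpha})\,d\alpha$. For $\gamma\in[0,1]$ the generator of the stochastic exchange process on $L^2(\mathcal S_{N,E},\sigma_{N,E})$ is $$L_{\gamma,N,E}f(\boldsymbol\eta)=-N\binom N2^{-1}\sum_{i<j}(\eta_i+\eta_j)^\gamma\left[f(\boldsymbol\eta)-[f]^{(i,j)}(\boldsymbol\eta)\right],$$ and its spectral gap is $$\Delta_{\gamma,N,E}=\inf\{-\langle f,L_{\gamma,N,E}f\rangle:\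 f\in L^2(\mathcal S_{N,E},\sigma_{N,E}),\ \|f\|_2=1,\ \langle f,1\rangle=0\},\qquad \Delta_{\gamma,N}=\Delta_{\gamma,N,1}.$$ Let $P_k$ be the orthogonal projection of $L^2(\mathcal S_N,\sigma_N)$ onto the functions depending only on $\eta_k$ (conditional expectation given $\eta_k$), and let $$\mathcal G_{\gamma,N}(f,f)=\frac1N\sum_{k=1}^N\int_{\mathcal S_N}\left(\frac{N-\eta_k}{N-1}\right)^{\gamma}(f-P_kf)^2\,d\sigma_N,$$ $$\Gamma_{\gamma,N}=\inf\{\mathcal G_{\gamma,N}(f,f):\ f\in L^2(\mathcal S_N,\sigma_N),\ \|f\|_2=1,\ \langle f,1\rangle=0\}.$$ **Theorem.** For all $N\ge3$, $\Gamma_{1,N}$ is strictly positive and $$\Gamma_{1,N}\ \ge\ 1-\frac1{N-1}-\frac2{N(N-1)}.$$ Moreover $\Delta_{1,N}$ is bounded below uniformly in $N\ge3$: the infinite product below converges, and for all $N\ge 3$ $$\Delta_{1,N}\ \ge\ 4\prod_{j=3}^\infty\left(1-\frac3{(j-1)^2}\right)\ >\ 0.$$ -/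

import Mathlib

open MeasureTheory ProbabilityTheory

noncomputable section

namespace StochasticExchange

/-- The state space `S_{N,E}`: configurations of `N` nonnegative energies with mean energy `E`,
that is, with total energy `N * E`. -/
def stateSpace (N : ℕ) (E : ℝ) : Set (Fin N → ℝ) :=
  {η | (∀ k, 0 ≤ η k) ∧ ∑ k, η k = N * E}

/-- The affine parametrization of the hyperplane `∑ k, η k = N * E` by its first `N - 1`
coordinates; the last coordinate is determined by the constraint. -/
def chart (N : ℕ) (E : ℝ) (ξ : Fin (N - 1) → ℝ) : Fin N → ℝ :=
  fun k => if h : (k : ℕ) < N - 1 then ξ ⟨k, h⟩ else N * E - ∑ i, ξ i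

/-- The uniform probability measure `σ_{N,E}` on the simplex `S_{N,E}`: normalized
`(N - 1)`-dimensional Lebesgue measure on the simplex, computed in the affine parametrization
`chart` (an affine parametrization has constant Jacobian, so normalization makes the result
independent of the parametrization). It is a measure on `ℝ^N` carried by `stateSpace N E`. -/
def sigma (N : ℕ) (E : ℝ) : Measure (Fin N → ℝ) :=
  (cond (volume : Measure (Fin (N - 1) → ℝ)) (chart N E ⁻¹' stateSpace N E)).map (chart N E)

/-- The configuration `η*_{i,j,α}` after an energy exchange between particles `i` and `j`: their
total energy `η i + η j` is divided anew, in the proportion `α : 1 - α`. -/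
def exchange {N : ℕ} (i j : Fin N) (α : ℝ) (η : Fin N → ℝ) : Fin N → ℝ :=
  fun k => if k = i then α * (η i + η j)
    else if k = j then (1 - α) * (η i + η j)
    else η k

/-- `[f]^{(i,j)}(η) = ∫_0^1 f(η*_{i,j,α}) dα`. -/
def exchangeAverage {N : ℕ} (i j : Fin N) (f : (Fin N → ℝ) → ℝ) (η : Fin N → ℝ) : ℝ :=
  ∫ α in (0 : ℝ)..1, f (exchange i j α η)

/-- The generator `L_{γ,N}` of the stochastic exchange process: the pair `i < j` jumps from `η`
to `η*_{i,j,α}`, with `α` uniform in `[0,1]`, at rate `N (N choose 2)⁻¹ (η_i + η_j)^γ`. -/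
def generator (γ : ℝ) (N : ℕ) (f : (Fin N → ℝ) → ℝ) (η : Fin N → ℝ) : ℝ :=
  -((N : ℝ) * ((N.choose 2 : ℕ) : ℝ)⁻¹) *
    ∑ p ∈ (Finset.univ : Finset (Fin N × Fin N)).filter (fun p => p.1 < p.2),
      (η p.1 + η p.2) ^ γ * (f η - exchangeAverage p.1 p.2 f η)

/-- The Dirichlet form `ℰ_{γ,N,E}(f,f) = -⟨f, L_{γ,N,E} f⟩` in `L²(S_{N,E}, σ_{N,E})`. -/
def dirichletForm (γ : ℝ) (N : ℕ) (E : ℝ) (f : (Fin N → ℝ) → ℝ) : ℝ :=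
  -∫ η, f η * generator γ N f η ∂(sigma N E)

/-- `f` is (a representative of) a unit vector of `L²(S_{N,E}, σ_{N,E})` that is orthogonal to
the constants. -/
def IsTrial (N : ℕ) (E : ℝ) (f : (Fin N → ℝ) → ℝ) : Prop :=
  MemLp f 2 (sigma N E) ∧ ∫ η, f η ^ 2 ∂(sigma N E) = 1 ∧ ∫ η, f η ∂(sigma N E) = 0

/-- The spectral gap `Δ_{γ,N,E}`. -/
def gapE (γ : ℝ) (N : ℕ) (E : ℝ) : ℝ :=
  sInf {r | ∃ f, IsTrial N E f ∧ r = dirichletForm γ N E f}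

/-- The spectral gap `Δ_{γ,N} = Δ_{γ,N,1}` at unit energy per particle. -/
def Delta (γ : ℝ) (N : ℕ) : ℝ := gapE γ N 1

/-- `P_k f`: the conditional expectation of `f` given `η_k` under `σ_N = σ_{N,1}`, that is, the
orthogonal projection of `f` onto the functions in `L²(σ_N)` that depend only on `η_k`. -/
def condProj (N : ℕ) (k : Fin N) (f : (Fin N → ℝ) → ℝ) : (Fin N → ℝ) → ℝ :=
  condExp (MeasurableSpace.comap (fun η : Fin N → ℝ => η k) inferInstance) (sigma N 1) f

/-- The weight `w_N^{(γ)}(x) = ((N - x) / (N - 1))^γ`. -/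
def weight (γ : ℝ) (N : ℕ) (x : ℝ) : ℝ := (((N : ℝ) - x) / ((N : ℝ) - 1)) ^ γ

/-- The quadratic form `𝒢_{γ,N}(f,f) = N⁻¹ ∑_k ∫ w_N^{(γ)}(η_k) (f - P_k f)² dσ_N`. -/
def gForm (γ : ℝ) (N : ℕ) (f : (Fin N → ℝ) → ℝ) : ℝ :=
  (1 / (N : ℝ)) * ∑ k : Fin N,
    ∫ η, weight γ N (η k) * (f η - condProj N k f η) ^ 2 ∂(sigma N 1)

/-- The spectral gap `Γ_{γ,N}` of the form `𝒢_{γ,N}`. -/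
def Gamma (γ : ℝ) (N : ℕ) : ℝ :=
  sInf {r | ∃ f, IsTrial N 1 f ∧ r = gForm γ N f}

end StochasticExchange

end

noncomputable section

namespace StochasticExchange

open scoped RealInnerProductSpace

/-! ### The uniform measure in coordinates -/

/-! The gap is bounded by induction on the number of particles, conditioning on one energy at a
time. Given `η k = x`, the other particles, rescaled by `ratio n x`, again follow the uniform law
(`measurePreserving_insertScaled`). For γ = 1 the rates are homogeneous of degree one, so each slice
carries the smaller process with rates multiplied by `ratio`, which is the weight in `gForm`.
Applying the gap for N - 1 particles on every slice and averaging over k, with each pair counted N -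
2 times, gives Δ_N ≥ (N/(N-1)) Δ_{N-1} Γ_N (`le_dirichletForm_of_hasGap`).

To bound Γ_N, expand the square: the weights sum to N and each is at most N/(N-1), so it suffices
that ∑ ‖P_k f‖² ≤ (1 + 2/N) ‖f‖² for mean-zero f (`sum_integral_condMean_sq_le`). By duality this is
a norm bound for ∑ h_k(η_k), governed by the correlation operator K of two coordinates. K is
symmetric, preserves polynomial degree filtrations and is triangular on monomials, so its diagonal
entries are its eigenvalues; off the constants they are at most the normalized second moment
2/(N(N-1)) (`eigenvalue_le`, `inner_correlation_le`). The lower bound K ≥ -1/(N-1) comes from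
positivity of a norm (`norm_sum_isometry_sq_le`).

Together (N/(N-1)) Γ_N ≥ 1 - 3/(N-1)². For two particles a single exchange resamples the whole
configuration, so the gap inequality holds with constant 4, and the product of the factors converges
to a positive limit.

All symmetry of the uniform law is drawn from one fact: an exchange with the last coordinate
preserves it, because in the chart it resamples one coordinate uniformly on its fibre. -/

/-- Append a last coordinate so that the total becomes `c`. -/
def complete (n : ℕ) (c : ℝ) (ξ : Fin n → ℝ) : Fin (n + 1) → ℝ :=
  Fin.snoc ξ (c - ∑ i, ξ i)

/-- The solid simplex `{ξ ≥ 0, ∑ ξ ≤ c}`. -/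
def subsimplex (n : ℕ) (c : ℝ) : Set (Fin n → ℝ) :=
  {ξ | (∀ i, 0 ≤ ξ i) ∧ ∑ i, ξ i ≤ c}

lemma measurable_complete (n : ℕ) (c : ℝ) : Measurable (complete n c) := by
  refine measurable_pi_iff.2 fun k => ?_
  refine Fin.lastCases ?_ (fun i => ?_) k
  · simp only [complete, Fin.snoc_last]; fun_prop
  · simp only [complete, Fin.snoc_castSucc]; fun_prop

lemma sum_complete (n : ℕ) (c : ℝ) (ξ : Fin n → ℝ) : ∑ k, complete n c ξ k = c := by
  simp [complete, Fin.sum_univ_castSucc]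

lemma measurableSet_subsimplex (n : ℕ) (c : ℝ) : MeasurableSet (subsimplex n c) := by
  have h : subsimplex n c = (⋂ i, {ξ : Fin n → ℝ | 0 ≤ ξ i}) ∩ {ξ | ∑ i, ξ i ≤ c} := by
    ext ξ; simp [subsimplex]
  rw [h]
  exact (MeasurableSet.iInter fun i => measurableSet_le measurable_const
    (measurable_pi_apply i)).inter (measurableSet_le (by fun_prop) measurable_const)

lemma chart_succ (n : ℕ) (E : ℝ) : chart (n + 1) E = complete n (((n + 1 : ℕ) : ℝ) * E) := by
  funext ξ k
  refine Fin.lastCases ?_ (fun i => ?_) k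
  · simp [chart, complete]
  · simp [chart, complete]

lemma preimage_stateSpace (n : ℕ) (c : ℝ) (E : ℝ) (h : ((n + 1 : ℕ) : ℝ) * E = c) :
    complete n c ⁻¹' stateSpace (n + 1) E = subsimplex n c := by
  ext ξ
  simp only [Set.mem_preimage, stateSpace, subsimplex, Set.mem_ofPred_eq, sum_complete, h, and_true]
  constructor
  · intro H
    refine ⟨fun i => by simpa [complete] using H i.castSucc, ?_⟩
    simpa [complete] using H (Fin.last n)
  · rintro ⟨h1, h2⟩ k
    refine Fin.lastCases ?_ (fun i => ?_) k
    · simpa [complete] using h2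
    · simpa [complete] using h1 i

lemma sigma_succ (n : ℕ) : sigma (n + 1) 1 =
    (cond (volume : Measure (Fin n → ℝ)) (subsimplex n (n + 1))).map (complete n (n + 1)) := by
  have h : ((n + 1 : ℕ) : ℝ) * 1 = (n : ℝ) + 1 := by push_cast; ring
  rw [← preimage_stateSpace n (n + 1) 1 h, ← h, ← chart_succ]
  rfl

lemma volume_subsimplex_ne_top (n : ℕ) (c : ℝ) : volume (subsimplex n c) ≠ ⊤ := by
  refine measure_ne_top_of_subset (s := Set.Icc (0 : Fin n → ℝ) (fun _ => c)) ?_ ?_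
  · rintro ξ ⟨h1, h2⟩
    exact ⟨fun i => h1 i, fun i =>
      (Finset.single_le_sum (f := ξ) (fun j _ => h1 j) (Finset.mem_univ i)).trans h2⟩
  · exact (isCompact_Icc.measure_lt_top).ne

lemma volume_subsimplex_ne_zero (n : ℕ) {c : ℝ} (hc : (n : ℝ) ≤ c) :
    volume (subsimplex n c) ≠ 0 := by
  have hsub : (Set.univ.pi fun _ : Fin n => Set.Ioo (0 : ℝ) 1) ⊆ subsimplex n c := by
    intro ξ hξ
    simp only [Set.mem_pi, Set.mem_univ, true_imp_iff, Set.mem_Ioo] at hξ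
    refine ⟨fun i => (hξ i).1.le, ?_⟩
    calc ∑ i, ξ i ≤ ∑ _i : Fin n, (1 : ℝ) := Finset.sum_le_sum fun i _ => (hξ i).2.le
      _ ≤ c := by simpa using hc
  intro h0
  have := measure_mono_null hsub h0
  simp [volume_pi_pi] at this

instance isProbabilityMeasure_sigma (n : ℕ) : IsProbabilityMeasure (sigma (n + 1) 1) := by
  rw [sigma_succ]
  have : IsProbabilityMeasure (cond (volume : Measure (Fin n → ℝ)) (subsimplex n (n + 1))) :=
    cond_isProbabilityMeasure_of_finite (volume_subsimplex_ne_zero n (by linarith))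
      (volume_subsimplex_ne_top n _)
  exact Measure.isProbabilityMeasure_map (measurable_complete _ _).aemeasurable

lemma measurableSet_stateSpace (N : ℕ) (E : ℝ) : MeasurableSet (stateSpace N E) := by
  have h : stateSpace N E = (⋂ i, {η : Fin N → ℝ | 0 ≤ η i}) ∩ {η | ∑ i, η i = N * E} := by
    ext η; simp [stateSpace]
  rw [h]
  exact (MeasurableSet.iInter fun i => measurableSet_le measurable_const
    (measurable_pi_apply i)).inter (measurableSet_eq_fun (by fun_prop) measurable_const)

lemma ae_mem_stateSpace (n : ℕ) : ∀ᵐ η ∂(sigma (n + 1) 1), η ∈ stateSpace (n + 1) 1 := by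
  rw [sigma_succ, ae_map_iff (p := fun η => η ∈ stateSpace (n + 1) 1)
    (measurable_complete _ _).aemeasurable (measurableSet_stateSpace _ _)]
  have h : ((n + 1 : ℕ) : ℝ) * 1 = (n : ℝ) + 1 := by push_cast; ring
  filter_upwards [ae_cond_mem (μ := volume) (measurableSet_subsimplex n (n + 1))] with ξ hξ
  rw [← preimage_stateSpace n _ 1 h] at hξ
  exact hξ

lemma lintegral_sigma (n : ℕ) {g : (Fin (n + 1) → ℝ) → ENNReal} (hg : Measurable g) :
    ∫⁻ η, g η ∂(sigma (n + 1) 1) = (volume (subsimplex n (n + 1)))⁻¹ *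
      ∫⁻ ξ in subsimplex n (n + 1), g (complete n (n + 1) ξ) := by
  rw [sigma_succ, lintegral_map hg (measurable_complete _ _), ProbabilityTheory.cond,
    lintegral_smul_measure, smul_eq_mul]

/-! ### Slicing the solid simplex -/

lemma mem_subsimplex_insertNth {m : ℕ} (i : Fin (m + 1)) (c x : ℝ) (ξ : Fin m → ℝ) :
    (i.insertNth x ξ : Fin (m + 1) → ℝ) ∈ subsimplex (m + 1) c ↔
      0 ≤ x ∧ (∀ j, 0 ≤ ξ j) ∧ x + ∑ j, ξ j ≤ c := by
  simp only [subsimplex, Set.mem_ofPred_eq, Fin.sum_univ_succAbove _ i, Fin.insertNth_apply_same,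
    Fin.insertNth_apply_succAbove, Fin.forall_iff_succAbove i, and_assoc]

lemma measurable_insertNth {m : ℕ} (i : Fin (m + 1)) :
    Measurable fun z : ℝ × (Fin m → ℝ) => (i.insertNth z.1 z.2 : Fin (m + 1) → ℝ) :=
  (MeasurableEquiv.piFinSuccAbove (fun _ : Fin (m + 1) => ℝ) i).symm.measurable

lemma lintegral_pi_insertNth {m : ℕ} (i : Fin (m + 1)) {G : (Fin (m + 1) → ℝ) → ENNReal} :
    ∫⁻ ξ, G ξ = ∫⁻ z : ℝ × (Fin m → ℝ), G (i.insertNth z.1 z.2) :=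
  ((volume_preserving_piFinSuccAbove (fun _ : Fin (m + 1) => ℝ) i).symm _
    |>.lintegral_comp_emb (MeasurableEquiv.measurableEmbedding _) G).symm

/-- The sliced coordinate is outermost here, which leads to conditioning on one energy; in
`lintegral_subsimplex_last` it is innermost, which exhibits its uniform law on an interval once the
others are fixed. -/
lemma lintegral_subsimplex_first {m : ℕ} (i : Fin (m + 1)) (c : ℝ)
    {G : (Fin (m + 1) → ℝ) → ENNReal} (hG : Measurable G) :
    ∫⁻ ξ in subsimplex (m + 1) c, G ξ =
      ∫⁻ x in Set.Icc 0 c, ∫⁻ ξ in subsimplex m (c - x), G (i.insertNth x ξ) := by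
  have hm : Measurable fun z : ℝ × (Fin m → ℝ) =>
      (subsimplex (m + 1) c).indicator G (i.insertNth z.1 z.2) :=
    (hG.indicator (measurableSet_subsimplex _ _)).comp (measurable_insertNth i)
  rw [← lintegral_indicator (measurableSet_subsimplex _ _), lintegral_pi_insertNth i,
    Measure.volume_eq_prod, lintegral_prod _ hm.aemeasurable,
    ← lintegral_indicator measurableSet_Icc]
  refine lintegral_congr fun x => ?_
  by_cases hx : x ∈ Set.Icc 0 c
  · rw [Set.indicator_of_mem hx, ← lintegral_indicator (measurableSet_subsimplex _ _)]
    refine lintegral_congr fun ξ => ?_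
    by_cases h : ξ ∈ subsimplex m (c - x)
    · rw [Set.indicator_of_mem h, Set.indicator_of_mem]
      exact (mem_subsimplex_insertNth i c x ξ).2 ⟨hx.1, h.1, by linarith [h.2]⟩
    · rw [Set.indicator_of_notMem h, Set.indicator_of_notMem]
      intro h'
      obtain ⟨_, h2, h3⟩ := (mem_subsimplex_insertNth i c x ξ).1 h'
      exact h ⟨h2, by linarith⟩
  · rw [Set.indicator_of_notMem hx]
    refine (lintegral_congr fun ξ => ?_).trans lintegral_zero
    rw [Set.indicator_of_notMem]
    intro h'
    obtain ⟨h1, h2, h3⟩ := (mem_subsimplex_insertNth i c x ξ).1 h'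
    exact hx ⟨h1, by linarith [Finset.sum_nonneg fun j (_ : j ∈ Finset.univ) => h2 j]⟩

lemma lintegral_subsimplex_last {m : ℕ} (i : Fin (m + 1)) (c : ℝ)
    {G : (Fin (m + 1) → ℝ) → ENNReal} (hG : Measurable G) :
    ∫⁻ ξ in subsimplex (m + 1) c, G ξ =
      ∫⁻ ξ in subsimplex m c, ∫⁻ x in Set.Ioc 0 (c - ∑ j, ξ j), G (i.insertNth x ξ) := by
  have hm : Measurable fun z : ℝ × (Fin m → ℝ) =>
      (subsimplex (m + 1) c).indicator G (i.insertNth z.1 z.2) :=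
    (hG.indicator (measurableSet_subsimplex _ _)).comp (measurable_insertNth i)
  rw [← lintegral_indicator (measurableSet_subsimplex _ _), lintegral_pi_insertNth i,
    Measure.volume_eq_prod, lintegral_prod_symm _ hm.aemeasurable,
    ← lintegral_indicator (measurableSet_subsimplex _ _)]
  refine lintegral_congr fun ξ => ?_
  by_cases hξ : ξ ∈ subsimplex m c
  · rw [Set.indicator_of_mem hξ, setLIntegral_congr Ioc_ae_eq_Icc,
      ← lintegral_indicator measurableSet_Icc]
    refine lintegral_congr fun x => ?_
    by_cases h : x ∈ Set.Icc 0 (c - ∑ j, ξ j)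
    · rw [Set.indicator_of_mem h, Set.indicator_of_mem]
      exact (mem_subsimplex_insertNth i c x ξ).2 ⟨h.1, hξ.1, by linarith [h.2]⟩
    · rw [Set.indicator_of_notMem h, Set.indicator_of_notMem]
      intro h'
      obtain ⟨h1, _, h3⟩ := (mem_subsimplex_insertNth i c x ξ).1 h'
      exact h ⟨h1, by linarith⟩
  · rw [Set.indicator_of_notMem hξ]
    refine (lintegral_congr fun x => ?_).trans lintegral_zero
    rw [Set.indicator_of_notMem]
    intro h'
    obtain ⟨h1, h2, h3⟩ := (mem_subsimplex_insertNth i c x ξ).1 h'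
    exact hξ ⟨h2, by linarith⟩

/-! ### Scaling -/

lemma lintegral_Ioc_scale {s : ℝ} (hs : 0 ≤ s) {G : ℝ → ENNReal} (hG : Measurable G) :
    ENNReal.ofReal s * ∫⁻ α in Set.Ioc (0 : ℝ) 1, G (α * s) = ∫⁻ y in Set.Ioc 0 s, G y := by
  rcases hs.eq_or_lt with rfl | hs
  · simp
  have h := Measure.map_addHaar_smul (volume : Measure ℝ) hs.ne'
  have h2 : ∫⁻ α in Set.Ioc (0 : ℝ) 1, G (α * s) =
      ∫⁻ α, (Set.Ioc 0 s).indicator G (s • α) := by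
    rw [← lintegral_indicator measurableSet_Ioc]
    refine lintegral_congr fun α => ?_
    by_cases hα : α ∈ Set.Ioc (0 : ℝ) 1
    · rw [Set.indicator_of_mem hα, Set.indicator_of_mem, smul_eq_mul, mul_comm]
      exact ⟨mul_pos hs hα.1, by simpa using mul_le_mul_of_nonneg_left hα.2 hs.le⟩
    · rw [Set.indicator_of_notMem hα, Set.indicator_of_notMem]
      rintro ⟨h1, h2⟩
      rw [smul_eq_mul] at h1 h2
      exact hα ⟨pos_of_mul_pos_right h1 hs.le, by
        rwa [mul_le_iff_le_one_right hs] at h2⟩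
  rw [h2, ← lintegral_map (f := (Set.Ioc 0 s).indicator G) (g := fun x : ℝ => s • x)
    (hG.indicator measurableSet_Ioc) (by fun_prop), h, lintegral_smul_measure,
    lintegral_indicator measurableSet_Ioc, smul_eq_mul, ← mul_assoc,
    ← ENNReal.ofReal_mul hs.le]
  simp [abs_of_pos hs, hs.ne']

lemma lintegral_subsimplex_scale {m : ℕ} {w : ℝ} (hw : 0 < w) (c : ℝ)
    {G : (Fin m → ℝ) → ENNReal} (hG : Measurable G) :
    ∫⁻ ξ in subsimplex m (w * c), G ξ =
      ENNReal.ofReal (w ^ m) * ∫⁻ ξ in subsimplex m c, G (w • ξ) := by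
  have h := Measure.map_addHaar_smul (volume : Measure (Fin m → ℝ)) hw.ne'
  have h2 : ∫⁻ ξ in subsimplex m c, G (w • ξ) =
      ∫⁻ ξ, (subsimplex m (w * c)).indicator G (w • ξ) := by
    rw [← lintegral_indicator (measurableSet_subsimplex _ _)]
    refine lintegral_congr fun ξ => ?_
    have : w • ξ ∈ subsimplex m (w * c) ↔ ξ ∈ subsimplex m c := by
      simp [subsimplex, ← Finset.mul_sum, hw]
    by_cases hα : ξ ∈ subsimplex m c
    · rw [Set.indicator_of_mem hα, Set.indicator_of_mem (this.2 hα)]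
    · rw [Set.indicator_of_notMem hα, Set.indicator_of_notMem (mt this.1 hα)]
  rw [h2, ← lintegral_map (f := (subsimplex m (w * c)).indicator G)
    (g := fun x : Fin m → ℝ => w • x)
    (hG.indicator (measurableSet_subsimplex _ _)) (by fun_prop), h, lintegral_smul_measure,
    lintegral_indicator (measurableSet_subsimplex _ _), smul_eq_mul, ← mul_assoc,
    ← ENNReal.ofReal_mul (by positivity)]
  have : w ^ m * |(w ^ m)⁻¹| = 1 := by
    rw [abs_of_pos (by positivity), mul_inv_cancel₀ (by positivity)]
  rw [Module.finrank_fin_fun, this, ENNReal.ofReal_one, one_mul]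

/-! ### Exchanges preserve the uniform measure -/

lemma measurable_exchange {N : ℕ} (i j : Fin N) :
    Measurable fun z : ℝ × (Fin N → ℝ) => exchange i j z.1 z.2 := by
  refine measurable_pi_iff.2 fun k => ?_
  unfold exchange
  split_ifs <;> fun_prop

/-- The pair has total `c - ∑ ξ`, which does not involve `x`, so in the chart the exchange
overwrites a single coordinate. -/
lemma exchange_complete {m : ℕ} (i : Fin (m + 1)) (c x α : ℝ) (ξ : Fin m → ℝ) :
    exchange i.castSucc (Fin.last (m + 1)) α (complete (m + 1) c (i.insertNth x ξ)) =
      complete (m + 1) c (i.insertNth (α * (c - ∑ j, ξ j)) ξ) := by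
  have hs : ∀ y : ℝ, ∑ j, (i.insertNth y ξ : Fin (m + 1) → ℝ) j = y + ∑ j, ξ j := by
    intro y
    simp [Fin.sum_univ_succAbove _ i]
  funext k
  refine Fin.lastCases ?_ (fun j => ?_) k
  · simp only [exchange, complete, Fin.snoc_last, Fin.snoc_castSucc, hs,
      (Fin.castSucc_lt_last i).ne', if_false, if_true, Fin.insertNth_apply_same]
    ring
  · rcases Fin.eq_self_or_eq_succAbove i j with rfl | ⟨l, rfl⟩
    · simp only [exchange, complete, Fin.snoc_last, Fin.snoc_castSucc, hs,
        if_true, Fin.insertNth_apply_same]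
      ring
    · have h1 : (i.succAbove l).castSucc ≠ i.castSucc := fun h =>
        Fin.succAbove_ne i l (Fin.castSucc_injective _ h)
      simp [exchange, complete, h1, (Fin.castSucc_lt_last (i.succAbove l)).ne]

/-- The uniform law on `[0, 1]` of the proportion `α`. -/
def unitLaw : Measure ℝ := volume.restrict (Set.Ioc 0 1)

instance : IsProbabilityMeasure unitLaw := ⟨by simp [unitLaw]⟩

/-- With the other chart coordinates fixed, coordinate `i` is uniform on `[0, s]`, where `s` is the
energy of the pair, and the exchange replaces it by `α * s`, which has the same law. -/
lemma measurePreserving_exchange_last {n : ℕ} (i : Fin n) :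
    MeasurePreserving (fun z : ℝ × (Fin (n + 1) → ℝ) => exchange i.castSucc (Fin.last n) z.1 z.2)
      (unitLaw.prod (sigma (n + 1) 1)) (sigma (n + 1) 1) := by
  refine ⟨measurable_exchange _ _, Measure.ext_of_lintegral _ fun g hg => ?_⟩
  have hge : Measurable fun z : ℝ × (Fin (n + 1) → ℝ) =>
      g (exchange i.castSucc (Fin.last n) z.1 z.2) := hg.comp (measurable_exchange _ _)
  obtain _ | m := n
  · exact i.elim0
  rw [lintegral_map hg (measurable_exchange _ _), lintegral_prod_symm _ hge.aemeasurable,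
    lintegral_sigma _ hg, lintegral_sigma _ hge.lintegral_prod_left']
  refine congrArg _ (((lintegral_subsimplex_last i _
    (hge.lintegral_prod_left'.comp (measurable_complete _ _))).trans ?_).trans
    (lintegral_subsimplex_last i _ (hg.comp (measurable_complete _ _))).symm)
  refine setLIntegral_congr_fun (measurableSet_subsimplex _ _) fun ξ hξ => ?_
  have hs : 0 ≤ ((m + 1 : ℕ) : ℝ) + 1 - ∑ j, ξ j := by linarith [hξ.2]
  simp only [Function.comp_apply, exchange_complete]
  rw [setLIntegral_const, Real.volume_Ioc, sub_zero, mul_comm]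
  refine lintegral_Ioc_scale hs (G := fun y => g (complete (m + 1) _ (i.insertNth y ξ))) ?_
  exact hg.comp ((measurable_complete _ _).comp ((measurable_insertNth i).comp
    (measurable_id.prodMk measurable_const)))

lemma measurePreserving_reflect : MeasurePreserving (fun α : ℝ => 1 - α) unitLaw unitLaw := by
  have h := (Measure.measurePreserving_sub_left (volume : Measure ℝ) 1).restrict_preimage
    (measurableSet_Ioc (a := (0 : ℝ)) (b := 1))
  have h2 : (fun α : ℝ => 1 - α) ⁻¹' Set.Ioc 0 1 = Set.Ico 0 1 := by
    simp
  rw [h2, restrict_Ico_eq_restrict_Ioc] at h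
  exact h

lemma exchange_swap {N : ℕ} {i j : Fin N} (hij : i ≠ j) (α : ℝ) (η : Fin N → ℝ) :
    exchange i j α η ∘ Equiv.swap i j = exchange i j (1 - α) η := by
  funext k
  by_cases h1 : k = i
  · subst h1; simp [exchange, hij.symm]
  · by_cases h2 : k = j
    · subst h2; simp [exchange, hij.symm]
    · simp [exchange, Equiv.swap_apply_of_ne_of_ne h1 h2, h1, h2]

lemma measurable_comp_perm {N : ℕ} (e : Equiv.Perm (Fin N)) :
    Measurable fun η : Fin N → ℝ => η ∘ e :=
  measurable_pi_iff.2 fun k => measurable_pi_apply (e k)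

/-- Swapping after an exchange amounts to replacing `α` by `1 - α`, which leaves `unitLaw`
invariant. Since `μ` is the law of the exchanged configuration, the swap preserves it. -/
lemma measurePreserving_swap {N : ℕ} {μ : Measure (Fin N → ℝ)} [SFinite μ] {i j : Fin N}
    (hij : i ≠ j)
    (h : MeasurePreserving (fun z : ℝ × (Fin N → ℝ) => exchange i j z.1 z.2)
      (unitLaw.prod μ) μ) :
    MeasurePreserving (fun η : Fin N → ℝ => η ∘ Equiv.swap i j) μ μ := by
  refine ⟨measurable_comp_perm _, ?_⟩
  have h3 := h.comp (measurePreserving_reflect.prod (MeasurePreserving.id μ))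
  conv_lhs => rw [← h.map_eq]
  rw [Measure.map_map (measurable_comp_perm _) h.measurable]
  refine Eq.trans ?_ h3.map_eq
  congr 1
  funext z
  exact exchange_swap hij _ _

lemma measurePreserving_perm {n : ℕ} (e : Equiv.Perm (Fin (n + 1))) :
    MeasurePreserving (fun η : Fin (n + 1) → ℝ => η ∘ e) (sigma (n + 1) 1) (sigma (n + 1) 1) := by
  have hl : ∀ i : Fin (n + 1), MeasurePreserving
      (fun η : Fin (n + 1) → ℝ => η ∘ Equiv.swap i (Fin.last n))
      (sigma (n + 1) 1) (sigma (n + 1) 1) := by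
    intro i
    refine Fin.lastCases ?_ (fun i => ?_) i
    · rw [Equiv.swap_self]; exact MeasurePreserving.id _
    · exact measurePreserving_swap (Fin.castSucc_lt_last i).ne (measurePreserving_exchange_last i)
  have hsw : ∀ i j : Fin (n + 1), i ≠ j → MeasurePreserving
      (fun η : Fin (n + 1) → ℝ => η ∘ Equiv.swap i j)
      (sigma (n + 1) 1) (sigma (n + 1) 1) := by
    intro i j hij
    by_cases hj : j = Fin.last n
    · subst hj; exact hl i
    by_cases hi : i = Fin.last n
    · subst hi; rw [Equiv.swap_comm]; exact hl j
    -- A general transposition is a conjugate of one with the last index by another such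
    -- transposition.
    have := ((hl j).comp (hl i)).comp (hl j)
    convert this using 1
    funext η
    simp only [Function.comp_apply, Function.comp_assoc]
    congr 1
    rw [← Equiv.Perm.coe_mul, ← Equiv.Perm.coe_mul, Equiv.swap_comm j (Fin.last n),
      ← mul_assoc, Equiv.swap_mul_swap_mul_swap hi hij, Equiv.swap_comm]
  induction e using Equiv.Perm.swap_induction_on with
  | one => exact MeasurePreserving.id _
  | swap_mul f x y hxy ih => 
    have := ih.comp (hsw x y hxy)
    simpa only [Function.comp_def, Equiv.Perm.mul_apply] using this

lemma exchange_comp_perm {N : ℕ} (e : Equiv.Perm (Fin N)) (i j : Fin N) (α : ℝ)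
    (η : Fin N → ℝ) : exchange (e i) (e j) α η ∘ e = exchange i j α (η ∘ e) := by
  funext k
  simp [exchange]

/-- Any pair is carried by a permutation to one containing the last index; conjugating by it reduces
to `measurePreserving_exchange_last`. -/
lemma measurePreserving_exchange {n : ℕ} {i j : Fin (n + 1)} (hij : i ≠ j) :
    MeasurePreserving (fun z : ℝ × (Fin (n + 1) → ℝ) => exchange i j z.1 z.2)
      (unitLaw.prod (sigma (n + 1) 1)) (sigma (n + 1) 1) := by
  have key : ∀ i : Fin n, ∀ e : Equiv.Perm (Fin (n + 1)), MeasurePreserving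
      (fun z : ℝ × (Fin (n + 1) → ℝ) => exchange (e.symm i.castSucc) (e.symm (Fin.last n)) z.1 z.2)
      (unitLaw.prod (sigma (n + 1) 1)) (sigma (n + 1) 1) := by
    intro i e
    have h := ((measurePreserving_perm e).comp (measurePreserving_exchange_last i)).comp
      ((MeasurePreserving.id unitLaw).prod (measurePreserving_perm e.symm))
    convert h using 1
    funext z
    have := exchange_comp_perm e (e.symm i.castSucc) (e.symm (Fin.last n)) z.1 (z.2 ∘ e.symm)
    simp only [Equiv.apply_symm_apply, Function.comp_assoc, Equiv.symm_comp_self,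
      Function.comp_id] at this
    exact this.symm
  have hex : ∃ e : Equiv.Perm (Fin (n + 1)), e j = Fin.last n := ⟨Equiv.swap j (Fin.last n), Equiv.swap_apply_left _ _⟩
  obtain ⟨e, he⟩ := hex
  have hi : e i ≠ Fin.last n := by
    rw [← he]; exact fun h => hij (e.injective h)
  obtain ⟨i', hi'⟩ := Fin.exists_castSucc_eq.2 hi
  have := key i' e
  rwa [hi', ← he, Equiv.symm_apply_apply, Equiv.symm_apply_apply] at this

/-! ### Disintegration with respect to one coordinate -/

/-- The law of one coordinate. -/
def marginal (n : ℕ) : Measure ℝ := (sigma (n + 1) 1).map fun η => η 0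

instance (n : ℕ) : IsProbabilityMeasure (marginal n) :=
  Measure.isProbabilityMeasure_map (measurable_pi_apply _).aemeasurable

/-- The mean energy of the remaining `n + 1` particles when one of `n + 2` has energy `x`. -/
def ratio (n : ℕ) (x : ℝ) : ℝ := ((n : ℝ) + 2 - x) / ((n : ℝ) + 1)

/-- Insert a particle of energy `x` at position `k` into a rescaled configuration. -/
def insertScaled {n : ℕ} (k : Fin (n + 2)) (z : ℝ × (Fin (n + 1) → ℝ)) : Fin (n + 2) → ℝ :=
  k.insertNth z.1 (ratio n z.1 • z.2)

lemma measurable_ratio (n : ℕ) : Measurable (ratio n) := by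
  unfold ratio; fun_prop

lemma measurable_insertScaled {n : ℕ} (k : Fin (n + 2)) : Measurable (insertScaled k) :=
  (measurable_insertNth k).comp (measurable_fst.prodMk
    (((measurable_ratio n).comp measurable_fst).smul measurable_snd))

lemma complete_insertNth {n : ℕ} {x : ℝ} (ζ : Fin n → ℝ) :
    complete (n + 1) (n + 1 + 1) ((0 : Fin (n + 1)).insertNth x (ratio n x • ζ)) =
      insertScaled 0 (x, complete n (n + 1) ζ) := by
  have hn : (n : ℝ) + 1 ≠ 0 := by positivity
  have hs : ∑ j, ((0 : Fin (n + 1)).insertNth x (ratio n x • ζ) : Fin (n + 1) → ℝ) j =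
      x + ratio n x * ∑ j, ζ j := by
    simp [Fin.sum_univ_succ, Finset.mul_sum]
  funext k
  refine Fin.cases ?_ (fun j => ?_) k
  · have : (0 : Fin (n + 2)) = Fin.castSucc (0 : Fin (n + 1)) := rfl
    rw [this]
    simp only [complete, Fin.snoc_castSucc, insertScaled]
    simp
  · refine Fin.lastCases ?_ (fun j => ?_) j
    · have : (Fin.last n).succ = Fin.last (n + 1) := rfl
      have hl : complete n (n + 1) ζ (Fin.last n) = n + 1 - ∑ j, ζ j := Fin.snoc_last _ _
      have hr : insertScaled 0 (x, complete n (n + 1) ζ) (Fin.last n).succ =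
          ratio n x * (n + 1 - ∑ j, ζ j) := by
        rw [← hl]; simp [insertScaled]
      rw [hr, this]
      simp only [complete, Fin.snoc_last]
      rw [hs, ratio]
      field_simp
      ring
    · have : j.castSucc.succ = j.succ.castSucc := rfl
      simp only [this, complete, Fin.snoc_castSucc]
      rw [← this]
      simp [insertScaled]

/-- The factor `ratio n x ^ n` is the Jacobian of rescaling the slice. The half-open interval
discards the endpoint where `ratio` vanishes. -/
lemma lintegral_sigma_disintegrate (n : ℕ) {g : (Fin (n + 2) → ℝ) → ENNReal}
    (hg : Measurable g) :
    ∫⁻ η, g η ∂(sigma (n + 2) 1) = (volume (subsimplex (n + 1) (((n + 1 : ℕ) : ℝ) + 1)))⁻¹ *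
      ∫⁻ x in Set.Ico 0 ((n : ℝ) + 1 + 1),
        ENNReal.ofReal (ratio n x ^ n) * (volume (subsimplex n (n + 1)) *
          ∫⁻ p, g (insertScaled 0 (x, p)) ∂(sigma (n + 1) 1)) := by
  rw [lintegral_sigma (n + 1) hg]
  refine congrArg _ ((lintegral_subsimplex_first 0 _ (hg.comp (measurable_complete _ _))).trans ?_)
  push_cast
  rw [setLIntegral_congr Ico_ae_eq_Icc.symm]
  refine setLIntegral_congr_fun measurableSet_Ico fun x hx => ?_
  have hw : 0 < ratio n x := div_pos (by linarith [hx.2]) (by positivity)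
  have hx2 : (n : ℝ) + 1 + 1 - x = ratio n x * (n + 1) := by
    unfold ratio; field_simp; ring
  have hgi : Measurable fun p => g (insertScaled 0 (x, p)) :=
    hg.comp ((measurable_insertScaled 0).comp (measurable_const.prodMk measurable_id))
  rw [hx2, lintegral_subsimplex_scale hw, lintegral_sigma n hgi, ← mul_assoc (volume _), ENNReal.mul_inv_cancel (volume_subsimplex_ne_zero n (by linarith))
      (volume_subsimplex_ne_top n _), one_mul]
  · simp only [Function.comp_apply, complete_insertNth]
  · exact hg.comp ((measurable_complete _ _).comp ((measurable_insertNth 0).comp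
      (measurable_const.prodMk measurable_id)))

/-- Disintegrating both `g` and its slice average yields the same expression, so the density of the
marginal never has to be computed. -/
lemma lintegral_sigma_eq_marginal (n : ℕ) {g : (Fin (n + 2) → ℝ) → ENNReal}
    (hg : Measurable g) :
    ∫⁻ η, g η ∂(sigma (n + 2) 1) =
      ∫⁻ x, ∫⁻ p, g (insertScaled 0 (x, p)) ∂(sigma (n + 1) 1) ∂(marginal (n + 1)) := by
  have hgm : Measurable fun x => ∫⁻ p, g (insertScaled 0 (x, p)) ∂(sigma (n + 1) 1) :=
    (hg.comp (measurable_insertScaled 0)).lintegral_prod_right'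
  have hgm0 : Measurable fun η : Fin (n + 2) → ℝ =>
      ∫⁻ p, g (insertScaled 0 (η 0, p)) ∂(sigma (n + 1) 1) := hgm.comp (measurable_pi_apply _)
  rw [marginal, lintegral_map hgm (measurable_pi_apply _), lintegral_sigma_disintegrate n hg,
    lintegral_sigma_disintegrate n hgm0]
  simp [insertScaled]

lemma measurePreserving_insertScaled_zero (n : ℕ) :
    MeasurePreserving (insertScaled (0 : Fin (n + 2)))
      ((marginal (n + 1)).prod (sigma (n + 1) 1)) (sigma (n + 2) 1) := by
  refine ⟨measurable_insertScaled 0, Measure.ext_of_lintegral _ fun g hg => ?_⟩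
  have hgc : Measurable fun z => g (insertScaled 0 z) := hg.comp (measurable_insertScaled 0)
  rw [lintegral_map hg (measurable_insertScaled 0), lintegral_sigma_eq_marginal n hg,
    lintegral_prod _ hgc.aemeasurable]

/-- Permutation invariance moves the distinguished coordinate from 0 to `k`. -/
lemma measurePreserving_insertScaled {n : ℕ} (k : Fin (n + 2)) :
    MeasurePreserving (insertScaled k)
      ((marginal (n + 1)).prod (sigma (n + 1) 1)) (sigma (n + 2) 1) := by
  have h := (measurePreserving_perm k.cycleRange).comp (measurePreserving_insertScaled_zero n)
  convert h using 1
  funext z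
  simp only [Function.comp_apply, insertScaled, Fin.insertNth_zero]
  exact (Fin.cons_comp_cycleRange _ _ _).symm

lemma measurePreserving_eval {n : ℕ} (k : Fin (n + 1)) :
    MeasurePreserving (fun η : Fin (n + 1) → ℝ => η k) (sigma (n + 1) 1) (marginal n) := by
  have h0 : MeasurePreserving (fun η : Fin (n + 1) → ℝ => η 0) (sigma (n + 1) 1) (marginal n) :=
    ⟨measurable_pi_apply _, rfl⟩
  have h := h0.comp (measurePreserving_perm (Equiv.swap 0 k))
  simpa [Function.comp_def] using h

@[simp] lemma insertScaled_same {n : ℕ} (k : Fin (n + 2)) (z : ℝ × (Fin (n + 1) → ℝ)) :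
    insertScaled k z k = z.1 := by simp [insertScaled]

@[simp] lemma insertScaled_succAbove {n : ℕ} (k : Fin (n + 2)) (z : ℝ × (Fin (n + 1) → ℝ))
    (j : Fin (n + 1)) : insertScaled k z (k.succAbove j) = ratio n z.1 * z.2 j := by
  simp [insertScaled]

/-- Exchanges are homogeneous, so they commute with the rescaling of the slice. -/
lemma exchange_insertScaled {n : ℕ} (k : Fin (n + 2)) (i j : Fin (n + 1)) (α x : ℝ)
    (p : Fin (n + 1) → ℝ) :
    exchange (k.succAbove i) (k.succAbove j) α (insertScaled k (x, p)) =
      insertScaled k (x, exchange i j α p) := by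
  funext l
  rcases Fin.eq_self_or_eq_succAbove k l with rfl | ⟨l, rfl⟩
  · simp [exchange, (Fin.succAbove_ne _ _).symm]
  · simp only [exchange, insertScaled_succAbove, Fin.succAbove_right_inj]
    split_ifs <;> ring

lemma ae_marginal (n : ℕ) : ∀ᵐ x ∂(marginal n), x ∈ Set.Icc (0 : ℝ) (n + 1) := by
  have h0 : AEMeasurable (fun η : Fin (n + 1) → ℝ => η 0) (sigma (n + 1) 1) :=
    (measurable_pi_apply _).aemeasurable
  rw [marginal, ae_map_iff (p := fun x : ℝ => x ∈ Set.Icc (0 : ℝ) (n + 1)) h0 measurableSet_Icc]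
  filter_upwards [ae_mem_stateSpace n] with η hη
  refine ⟨hη.1 0, ?_⟩
  have := Finset.single_le_sum (f := η) (fun j _ => hη.1 j) (Finset.mem_univ 0)
  rw [hη.2] at this
  simpa using this

/-! ### Second moments -/

lemma integrable_of_continuous {n : ℕ} {f : (Fin (n + 1) → ℝ) → ℝ} (hf : Continuous f) :
    Integrable f (sigma (n + 1) 1) := by
  have hK : IsCompact (Set.Icc (0 : Fin (n + 1) → ℝ) (fun _ => (n : ℝ) + 1)) := isCompact_Icc
  obtain ⟨C, hC⟩ := hK.exists_bound_of_continuousOn hf.continuousOn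
  refine Integrable.of_bound hf.aestronglyMeasurable C ?_
  filter_upwards [ae_mem_stateSpace n] with η hη
  refine hC η ⟨hη.1, fun k => ?_⟩
  have := Finset.single_le_sum (f := η) (fun j _ => hη.1 j) (Finset.mem_univ k)
  rw [hη.2] at this
  simpa using this

lemma integral_sq_eval {n : ℕ} (k : Fin (n + 1)) :
    ∫ η, η k ^ 2 ∂(sigma (n + 1) 1) = ∫ η, η 0 ^ 2 ∂(sigma (n + 1) 1) := by
  have h3 : ∀ k : Fin (n + 1), ∫ η, η k ^ 2 ∂(sigma (n + 1) 1) = ∫ x, x ^ 2 ∂(marginal n) := by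
    intro k
    rw [← (measurePreserving_eval k).map_eq, integral_map (measurable_pi_apply _).aemeasurable
      (by fun_prop)]
  rw [h3 k, h3 0]

/-- Invariance under the exchange of `i` and `j` expresses both moments through E(η_i + η_j)², with
factors ∫ α(1 - α) = 1/6 and ∫ α² = 1/3. -/
lemma integral_mul_eq {n : ℕ} {i j : Fin (n + 1)} (hij : i ≠ j) :
    ∫ η, η i * η j ∂(sigma (n + 1) 1) = (1 / 2) * ∫ η, η 0 ^ 2 ∂(sigma (n + 1) 1) := by
  have hmp := measurePreserving_exchange hij
  have hsplit : ∀ (a : ℝ → ℝ), Continuous a → ∫ z, a z.1 * (z.2 i + z.2 j) ^ 2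
      ∂(unitLaw.prod (sigma (n + 1) 1)) =
      (∫ α, a α ∂unitLaw) * ∫ η, (η i + η j) ^ 2 ∂(sigma (n + 1) 1) := fun a _ =>
    integral_prod_mul a fun η : Fin (n + 1) → ℝ => (η i + η j) ^ 2
  have h1 : ∫ η, η i * η j ∂(sigma (n + 1) 1) =
      (1 / 6) * ∫ η, (η i + η j) ^ 2 ∂(sigma (n + 1) 1) := by
    conv_lhs => rw [← hmp.map_eq]
    rw [integral_map hmp.measurable.aemeasurable (Continuous.aestronglyMeasurable (by fun_prop))]
    have : ∀ z : ℝ × (Fin (n + 1) → ℝ), exchange i j z.1 z.2 i * exchange i j z.1 z.2 j =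
        (z.1 * (1 - z.1)) * (z.2 i + z.2 j) ^ 2 := by
      intro z
      simp only [exchange, if_true, hij.symm, if_false]
      ring
    simp only [this]
    rw [hsplit (fun α => α * (1 - α)) (by fun_prop)]
    congr 1
    rw [unitLaw, ← intervalIntegral.integral_of_le zero_le_one]
    simp only [mul_sub, mul_one]
    rw [intervalIntegral.integral_sub (Continuous.intervalIntegrable (by fun_prop) _ _)
      (Continuous.intervalIntegrable (by fun_prop) _ _)]
    simp only [← pow_two, integral_pow, integral_id]
    norm_num
  have h2 : ∫ η, η i ^ 2 ∂(sigma (n + 1) 1) =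
      (1 / 3) * ∫ η, (η i + η j) ^ 2 ∂(sigma (n + 1) 1) := by
    conv_lhs => rw [← hmp.map_eq]
    rw [integral_map hmp.measurable.aemeasurable (Continuous.aestronglyMeasurable (by fun_prop))]
    have : ∀ z : ℝ × (Fin (n + 1) → ℝ), exchange i j z.1 z.2 i ^ 2 =
        z.1 ^ 2 * (z.2 i + z.2 j) ^ 2 := by
      intro z
      simp only [exchange, if_true]
      ring
    simp only [this]
    rw [hsplit (fun α => α ^ 2) (by fun_prop)]
    congr 1
    rw [unitLaw, ← intervalIntegral.integral_of_le zero_le_one]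
    simp only [integral_pow]
    norm_num
  rw [← integral_sq_eval i, h1, h2]
  ring

/-- The total energy is constant, so expanding its square and inserting `integral_mul_eq` leaves a
linear equation for the second moment. -/
lemma integral_sq (n : ℕ) :
    ∫ η, η 0 ^ 2 ∂(sigma (n + 1) 1) = 2 * ((n : ℝ) + 1) / (n + 2) := by
  set M := ∫ η, η 0 ^ 2 ∂(sigma (n + 1) 1) with hM
  have h1 : ∫ η, (∑ k, η k) ^ 2 ∂(sigma (n + 1) 1) = ((n : ℝ) + 1) ^ 2 := by
    have : (fun η : Fin (n + 1) → ℝ => (∑ k, η k) ^ 2) =ᵐ[sigma (n + 1) 1]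
        fun _ => ((n : ℝ) + 1) ^ 2 := by
      filter_upwards [ae_mem_stateSpace n] with η hη
      rw [hη.2]; push_cast; ring
    rw [integral_congr_ae this]; simp
  have h2 : ∫ η, (∑ k, η k) ^ 2 ∂(sigma (n + 1) 1) =
      ∑ i : Fin (n + 1), ∑ j : Fin (n + 1), ∫ η, η i * η j ∂(sigma (n + 1) 1) := by
    simp only [pow_two, Finset.sum_mul_sum]
    rw [integral_finsetSum _ fun i _ => integrable_of_continuous (by fun_prop)]
    exact Finset.sum_congr rfl fun i _ =>
      integral_finsetSum _ fun j _ => integrable_of_continuous (by fun_prop)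
  have h3 : ∀ i j : Fin (n + 1), ∫ η, η i * η j ∂(sigma (n + 1) 1) =
      1 / 2 * M + if i = j then 1 / 2 * M else 0 := by
    intro i j
    split_ifs with h
    · subst h
      simp only [← pow_two]
      rw [integral_sq_eval]; ring
    · rw [integral_mul_eq h]; ring
  rw [h1] at h2
  simp only [h3, Finset.sum_add_distrib, Finset.sum_const, Finset.card_univ, Fintype.card_fin,
    Finset.sum_ite_eq, Finset.mem_univ, if_true, nsmul_eq_mul] at h2
  push_cast at h2
  have hn : (n : ℝ) + 1 ≠ 0 := by positivity
  have hn2 : (n : ℝ) + 2 ≠ 0 := by positivity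
  rw [eq_div_iff hn2]
  apply mul_left_cancel₀ hn
  linear_combination -2 * h2

/-! ### Two facts about operators on a Hilbert space -/

/-- A symmetric operator that is triangular with nonnegative diagonal with respect to a total
sequence is positive. -/
lemma inner_nonneg_of_triangular {H : Type*} [NormedAddCommGroup H] [InnerProductSpace ℝ H]
    (B : H →L[ℝ] H) (hB : ∀ x y, ⟪B x, y⟫ = ⟪x, B y⟫) (e : ℕ → H)
    (he : Dense (Submodule.span ℝ (Set.range e) : Set H)) (d : ℕ → ℝ) (hd : ∀ n, 0 ≤ d n)
    (htri : ∀ n, B (e n) - d n • e n ∈ Submodule.span ℝ (e '' Set.Iio n)) (x : H) :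
    0 ≤ ⟪x, B x⟫ := by
  set f := InnerProductSpace.gramSchmidt ℝ e with hf
  have hBW : ∀ n, ∀ v ∈ Submodule.span ℝ (e '' Set.Iio n),
      B v ∈ Submodule.span ℝ (e '' Set.Iio n) := by
    intro n v hv
    induction hv using Submodule.span_induction with
    | mem v hv =>
      obtain ⟨m, hm, rfl⟩ := hv
      have h1 : B (e m) = (B (e m) - d m • e m) + d m • e m := by abel
      rw [h1]
      refine Submodule.add_mem _ ?_ (Submodule.smul_mem _ _ (Submodule.subset_span ⟨m, hm, rfl⟩))
      exact Submodule.span_mono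
        (Set.image_mono (Set.Iio_subset_Iio (le_of_lt hm))) (htri m)
    | zero => simp
    | add u v _ _ hu hv => rw [map_add]; exact Submodule.add_mem _ hu hv
    | smul a v _ hv => rw [map_smul]; exact Submodule.smul_mem _ _ hv
  have hdiff : ∀ n, e n - f n ∈ Submodule.span ℝ (e '' Set.Iio n) := by
    intro n
    rw [← InnerProductSpace.span_gramSchmidt_Iio, hf, InnerProductSpace.gramSchmidt_def,
      sub_sub_cancel]
    refine Submodule.sum_mem _ fun i hi => ?_
    have hsub : {InnerProductSpace.gramSchmidt ℝ e i} ⊆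
        InnerProductSpace.gramSchmidt ℝ e '' Set.Iio n :=
      Set.singleton_subset_iff.2 (Set.mem_image_of_mem _ (Finset.mem_Iio.1 hi))
    exact Submodule.span_mono hsub (Submodule.starProjection_apply_mem
      (Submodule.span ℝ {InnerProductSpace.gramSchmidt ℝ e i}) (e n))
  have horth : ∀ n, ∀ v ∈ Submodule.span ℝ (e '' Set.Iio n), ⟪f n, v⟫ = 0 := by
    intro n v hv
    rw [← InnerProductSpace.span_gramSchmidt_Iio] at hv
    induction hv using Submodule.span_induction with
    | mem v hv =>
      obtain ⟨m, hm, rfl⟩ := hv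
      exact InnerProductSpace.gramSchmidt_orthogonal ℝ e (ne_of_gt hm)
    | zero => simp
    | add u v _ _ hu hv => rw [inner_add_right, hu, hv, add_zero]
    | smul a v _ hv => rw [inner_smul_right, hv, mul_zero]
  -- Gram–Schmidt vectors are eigenvectors: `B (f n) - d n • f n` lies in the span of the earlier
  -- vectors, and by symmetry of `B` it is also orthogonal to that span.
  have heig : ∀ n, B (f n) = d n • f n := by
    intro n
    have hmem : B (f n) - d n • f n ∈ Submodule.span ℝ (e '' Set.Iio n) := by
      have : B (f n) - d n • f n =
          (B (e n) - d n • e n) - (B (e n - f n) - d n • (e n - f n)) := by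
        rw [map_sub, smul_sub]; abel
      rw [this]
      exact Submodule.sub_mem _ (htri n) (Submodule.sub_mem _ (hBW n _ (hdiff n))
        (Submodule.smul_mem _ _ (hdiff n)))
    have h0 : ⟪B (f n) - d n • f n, B (f n) - d n • f n⟫ = 0 := by
      conv_lhs => rw [inner_sub_left]
      rw [hB, inner_smul_left, horth n _ (hBW n _ hmem), horth n _ hmem]
      simp
    exact sub_eq_zero.1 (inner_self_eq_zero.1 h0)
  have hspan : ∀ y ∈ Submodule.span ℝ (Set.range e), 0 ≤ ⟪y, B y⟫ := by
    intro y hy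
    rw [← InnerProductSpace.span_gramSchmidt, Finsupp.mem_span_range_iff_exists_finsupp] at hy
    obtain ⟨c, rfl⟩ := hy
    rw [Finsupp.sum, map_sum, sum_inner]
    refine Finset.sum_nonneg fun i hi => ?_
    rw [inner_sum, Finset.sum_eq_single_of_mem i hi]
    · rw [map_smul, ← hf, heig i, inner_smul_left, inner_smul_right, inner_smul_right]
      have := hd i
      have h2 : (0 : ℝ) ≤ ⟪f i, f i⟫ := real_inner_self_nonneg
      have h3 : (c i) * (c i * (d i * ⟪f i, f i⟫)) = (c i) ^ 2 * (d i * ⟪f i, f i⟫) := by ring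
      simp only [RCLike.conj_to_real]
      rw [h3]
      positivity
    · intro j _ hji
      rw [map_smul, ← hf, heig j, inner_smul_left, inner_smul_right, inner_smul_right,
        InnerProductSpace.gramSchmidt_orthogonal ℝ e hji.symm]
      simp
  refine he.induction (P := fun x => 0 ≤ ⟪x, B x⟫) hspan ?_ x
  exact isClosed_le continuous_const (by fun_prop)

/-- A correlation bound for isometries with common pairwise correlation operator `K`. -/
lemma norm_sum_isometry_sq_le {H H' : Type*} [NormedAddCommGroup H] [InnerProductSpace ℝ H]
    [NormedAddCommGroup H'] [InnerProductSpace ℝ H'] {N : ℕ} (hN : 2 ≤ N)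
    (A : Fin N → H →ₗᵢ[ℝ] H') (K : H →L[ℝ] H)
    (hK : ∀ k l, k ≠ l → ∀ x y, ⟪A k x, A l y⟫ = ⟪x, K y⟫) (h : Fin N → H)
    (hup : ⟪∑ k, h k, K (∑ k, h k)⟫ ≤ 2 / (N * (N - 1)) * ‖∑ k, h k‖ ^ 2) :
    ‖∑ k, A k (h k)‖ ^ 2 ≤ (1 + 2 / N) * ∑ k, ‖h k‖ ^ 2 := by
  have hN2 : (2 : ℝ) ≤ N := by exact_mod_cast hN
  have hexp : ∀ g : Fin N → H, ‖∑ k, A k (g k)‖ ^ 2 =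
      ∑ k, ‖g k‖ ^ 2 - ∑ k, ⟪g k, K (g k)⟫ + ⟪∑ k, g k, K (∑ k, g k)⟫ := by
    intro g
    have h1 : ∀ k l, ⟪A k (g k), A l (g l)⟫ = ⟪g k, K (g l)⟫ +
        if k = l then ‖g k‖ ^ 2 - ⟪g k, K (g k)⟫ else 0 := by
      intro k l
      split_ifs with hkl
      · subst hkl
        rw [LinearIsometry.inner_map_map, real_inner_self_eq_norm_sq]; ring
      · rw [hK k l hkl, add_zero]
    rw [← real_inner_self_eq_norm_sq, sum_inner]
    simp only [inner_sum, h1, Finset.sum_add_distrib, Finset.sum_ite_eq, Finset.mem_univ, if_true,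
      Finset.sum_sub_distrib, map_sum, sum_inner]
    rw [Finset.sum_comm]
    ring
  have hlow : ∀ x : H, -⟪x, K x⟫ ≤ 1 / (N - 1) * ‖x‖ ^ 2 := by
    intro x
    -- Testing with equal entries gives 0 ≤ ‖∑ A_k x‖² = N‖x‖² + N(N-1)⟪x, Kx⟫.
    have h1 := hexp fun _ => x
    have h2 := sq_nonneg ‖∑ k, A k x‖
    rw [h1] at h2
    simp only [Finset.sum_const, Finset.card_univ, Fintype.card_fin,
      ← Nat.cast_smul_eq_nsmul ℝ, smul_eq_mul, map_smul, inner_smul_left, inner_smul_right,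
      RCLike.conj_to_real] at h2
    rw [div_mul_eq_mul_div, le_div_iff₀ (by linarith)]
    have h3 : 0 ≤ N * (‖x‖ ^ 2 + (N - 1) * ⟪x, K x⟫) := by linarith
    have h4 := nonneg_of_mul_nonneg_right h3 (by linarith)
    linarith
  set S := ∑ k, h k with hS
  have hNne : (N : ℝ) ≠ 0 := by linarith
  -- Split each `h k` into the mean `S / N` and a deviation: the lower bound on `K` controls the
  -- deviations, `hup` controls the mean, and each part costs a factor of at most 2/N.
  have hb1 : ∑ k, ‖h k - (N : ℝ)⁻¹ • S‖ ^ 2 = ∑ k, ‖h k‖ ^ 2 - (N : ℝ)⁻¹ * ‖S‖ ^ 2 := by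
    have : ∀ k, ‖h k - (N : ℝ)⁻¹ • S‖ ^ 2 =
        ‖h k‖ ^ 2 - 2 * (N : ℝ)⁻¹ * ⟪h k, S⟫ + ((N : ℝ)⁻¹) ^ 2 * ‖S‖ ^ 2 := by
      intro k
      rw [norm_sub_sq_real, inner_smul_right, norm_smul, mul_pow, Real.norm_eq_abs, sq_abs]; ring
    simp only [this, Finset.sum_add_distrib, Finset.sum_sub_distrib, ← Finset.mul_sum,
      ← sum_inner, ← hS, real_inner_self_eq_norm_sq, Finset.sum_const, Finset.card_univ,
      Fintype.card_fin, nsmul_eq_mul]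
    field_simp
    ring
  have hb2 : ∑ k, ⟪h k - (N : ℝ)⁻¹ • S, K (h k - (N : ℝ)⁻¹ • S)⟫ =
      ∑ k, ⟪h k, K (h k)⟫ - (N : ℝ)⁻¹ * ⟪S, K S⟫ := by
    simp only [map_sub, inner_sub_left, inner_sub_right, map_smul, inner_smul_left,
      inner_smul_right, RCLike.conj_to_real, Finset.sum_sub_distrib, ← Finset.mul_sum,
      ← sum_inner, ← inner_sum, ← map_sum, ← hS, Finset.sum_const, Finset.card_univ,
      Fintype.card_fin, ← Nat.cast_smul_eq_nsmul ℝ]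
    field_simp
    ring
  have hb3 : -∑ k, ⟪h k - (N : ℝ)⁻¹ • S, K (h k - (N : ℝ)⁻¹ • S)⟫ ≤
      1 / (N - 1) * ∑ k, ‖h k - (N : ℝ)⁻¹ • S‖ ^ 2 := by
    rw [← Finset.sum_neg_distrib, Finset.mul_sum]
    exact Finset.sum_le_sum fun k _ => hlow _
  have hb4 : 0 ≤ ∑ k, ‖h k - (N : ℝ)⁻¹ • S‖ ^ 2 := Finset.sum_nonneg fun k _ => sq_nonneg _
  have h5 : 1 / ((N : ℝ) - 1) ≤ 2 / N := by
    rw [div_le_div_iff₀ (by linarith) (by linarith)]; linarith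
  have h6 := hb3.trans (mul_le_mul_of_nonneg_right h5 hb4)
  have h7 : (1 - (N : ℝ)⁻¹) * ⟪S, K S⟫ ≤ (1 - (N : ℝ)⁻¹) * (2 / (N * (N - 1)) * ‖S‖ ^ 2) := by
    refine mul_le_mul_of_nonneg_left hup ?_
    rw [sub_nonneg]
    exact inv_le_one_of_one_le₀ (by linarith)
  have h8 : (1 - (N : ℝ)⁻¹) * (2 / (N * (N - 1)) * ‖S‖ ^ 2) = 2 / N * ((N : ℝ)⁻¹ * ‖S‖ ^ 2) := by
    have : (N : ℝ) - 1 ≠ 0 := by linarith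
    field_simp
  rw [hexp h]
  rw [hb1, hb2] at h6
  linarith

/-! ### The correlation operator of two coordinates -/

/-- Functions of the `k`-th coordinate. -/
def evalIsometry {n : ℕ} (k : Fin (n + 1)) :
    Lp ℝ 2 (marginal n) →ₗᵢ[ℝ] Lp ℝ 2 (sigma (n + 1) 1) :=
  Lp.compMeasurePreservingₗᵢ ℝ (fun η : Fin (n + 1) → ℝ => η k) (measurePreserving_eval k)

lemma coeFn_evalIsometry {n : ℕ} (k : Fin (n + 1)) (h : Lp ℝ 2 (marginal n)) :
    evalIsometry k h =ᵐ[sigma (n + 1) 1] fun η => h (η k) :=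
  Lp.coeFn_compMeasurePreserving h (measurePreserving_eval k)

lemma inner_Lp {α : Type*} {m : MeasurableSpace α} {μ : Measure α} (f g : Lp ℝ 2 μ) :
    ⟪f, g⟫ = ∫ a, f a * g a ∂μ := by
  rw [L2.inner_def]
  refine integral_congr_ae (Filter.Eventually.of_forall fun a => ?_)
  simp [mul_comm]

lemma inner_evalIsometry {n : ℕ} (k l : Fin (n + 1)) (h h' : Lp ℝ 2 (marginal n)) :
    ⟪evalIsometry k h, evalIsometry l h'⟫ = ∫ η, h (η k) * h' (η l) ∂(sigma (n + 1) 1) := by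
  rw [inner_Lp]
  refine integral_congr_ae ?_
  filter_upwards [coeFn_evalIsometry k h, coeFn_evalIsometry l h'] with η h1 h2
  rw [h1, h2]

lemma integral_comp_perm {n : ℕ} (e : Equiv.Perm (Fin (n + 1))) {F : (Fin (n + 1) → ℝ) → ℝ}
    (hF : StronglyMeasurable F) :
    ∫ η, F (η ∘ e) ∂(sigma (n + 1) 1) = ∫ η, F η ∂(sigma (n + 1) 1) := by
  conv_rhs => rw [← (measurePreserving_perm e).map_eq]
  rw [integral_map (measurable_comp_perm e).aemeasurable hF.aestronglyMeasurable]

lemma stronglyMeasurable_eval_mul {n : ℕ} (k l : Fin (n + 1)) (h h' : Lp ℝ 2 (marginal n)) :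
    StronglyMeasurable fun η : Fin (n + 1) → ℝ => h (η k) * h' (η l) :=
  ((Lp.stronglyMeasurable h).comp_measurable (measurable_pi_apply k)).mul
    ((Lp.stronglyMeasurable h').comp_measurable (measurable_pi_apply l))

/-- The correlation operator `K`, given by `⟪h, K h'⟫ = E[h(η₀) h'(η₁)]`. -/
def correlation (n : ℕ) : Lp ℝ 2 (marginal (n + 1)) →L[ℝ] Lp ℝ 2 (marginal (n + 1)) :=
  (ContinuousLinearMap.adjoint (evalIsometry (0 : Fin (n + 2))).toContinuousLinearMap).comp
    (evalIsometry (1 : Fin (n + 2))).toContinuousLinearMap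

lemma inner_correlation (n : ℕ) (h h' : Lp ℝ 2 (marginal (n + 1))) :
    ⟪h, correlation n h'⟫ = ∫ η, h (η 0) * h' (η 1) ∂(sigma (n + 2) 1) := by
  rw [← inner_evalIsometry]
  simp [correlation, ContinuousLinearMap.adjoint_inner_right]

lemma inner_evalIsometry_of_ne {n : ℕ} {k l : Fin (n + 2)} (hkl : k ≠ l)
    (h h' : Lp ℝ 2 (marginal (n + 1))) :
    ⟪evalIsometry k h, evalIsometry l h'⟫ = ⟪h, correlation n h'⟫ := by
  rw [inner_correlation, inner_evalIsometry]
  obtain ⟨e, he0, he1⟩ : ∃ e : Equiv.Perm (Fin (n + 2)), e 0 = k ∧ e 1 = l := by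
    refine ⟨(Equiv.swap (Equiv.swap 0 k 1) l) * Equiv.swap 0 k, ?_, ?_⟩
    · rw [Equiv.Perm.mul_apply, Equiv.swap_apply_left, Equiv.swap_apply_of_ne_of_ne _ hkl]
      intro h
      have := (Equiv.swap (0 : Fin (n + 2)) k).injective
        ((Equiv.swap_apply_left (0 : Fin (n + 2)) k).trans h)
      exact absurd this (by simp)
    · simp
  rw [← integral_comp_perm e (stronglyMeasurable_eval_mul 0 1 h h')]
  simp [he0, he1]

lemma correlation_symm (n : ℕ) (h h' : Lp ℝ 2 (marginal (n + 1))) :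
    ⟪correlation n h, h'⟫ = ⟪h, correlation n h'⟫ := by
  rw [real_inner_comm, ← inner_evalIsometry_of_ne (k := 0) (l := 1) (by simp) h' h,
    real_inner_comm, ← inner_evalIsometry_of_ne (k := 1) (l := 0) (by simp) h h']

/-! ### Polynomials in one coordinate -/

section

open Polynomial

lemma memLp_polynomial (n : ℕ) (p : ℝ[X]) : MemLp (fun x => p.eval x) 2 (marginal n) := by
  obtain ⟨C, hC⟩ := (isCompact_Icc (a := (0 : ℝ)) (b := n + 1)).exists_bound_of_continuousOn
    (p.continuous.continuousOn)
  refine MemLp.of_bound p.continuous.aestronglyMeasurable C ?_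
  filter_upwards [ae_marginal n] with x hx using hC x hx

/-- The class of a polynomial in `L²` of one coordinate. -/
def polyLp (n : ℕ) : ℝ[X] →ₗ[ℝ] Lp ℝ 2 (marginal n) where
  toFun p := (memLp_polynomial n p).toLp _
  map_add' p q := by
    rw [← MemLp.toLp_add]
    exact MemLp.toLp_congr _ _ (Filter.Eventually.of_forall fun x => by simp)
  map_smul' a p := by
    rw [RingHom.id_apply, ← MemLp.toLp_const_smul]
    exact MemLp.toLp_congr _ _ (Filter.Eventually.of_forall fun x => by simp)

lemma coeFn_polyLp (n : ℕ) (p : ℝ[X]) : polyLp n p =ᵐ[marginal n] fun x => p.eval x :=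
  (memLp_polynomial n p).coeFn_toLp

/-- Bounded continuous functions are dense, and Weierstrass applies because the marginal is carried
by a compact interval. -/
lemma dense_range_polyLp (n : ℕ) : Dense (Set.range (polyLp n)) := by
  intro h
  rw [Metric.mem_closure_iff]
  intro ε hε
  have hmem := Lp.memLp h
  obtain ⟨g, hg, hg2⟩ := hmem.exists_boundedContinuous_eLpNorm_sub_le (by simp)
    (ε := ENNReal.ofReal (ε / 4)) (by simp; linarith)
  obtain ⟨p, hp⟩ := exists_polynomial_near_of_continuousOn 0 ((n : ℝ) + 1) g
    g.continuous.continuousOn (ε / 4) (by linarith)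
  refine ⟨polyLp n p, ⟨p, rfl⟩, ?_⟩
  rw [dist_eq_norm, Lp.norm_def]
  have hgp : eLpNorm (fun x => g x - p.eval x) 2 (marginal n) ≤ ENNReal.ofReal (ε / 4) := by
    have := eLpNorm_le_of_ae_bound (p := 2) (μ := marginal n) (f := fun x => g x - p.eval x)
      (C := ε / 4) (by
        filter_upwards [ae_marginal n] with x hx
        rw [Real.norm_eq_abs, abs_sub_comm]
        exact (hp x hx).le)
    simpa using this
  have hle : eLpNorm (⇑(h - polyLp n p)) 2 (marginal n) ≤ ENNReal.ofReal (ε / 2) := by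
    have h1 : ⇑(h - polyLp n p) =ᵐ[marginal n]
        (fun x => h x - g x) + fun x => g x - p.eval x := by
      filter_upwards [Lp.coeFn_sub h (polyLp n p), coeFn_polyLp n p] with x h1 h2
      rw [h1]
      simp [h2]
    rw [eLpNorm_congr_ae h1]
    refine (eLpNorm_add_le ?_ ?_ (by norm_num)).trans ((add_le_add hg hgp).trans ?_)
    · exact hmem.1.sub g.continuous.aestronglyMeasurable
    · exact (g.continuous.sub p.continuous).aestronglyMeasurable
    · rw [← ENNReal.ofReal_add (by linarith) (by linarith)]
      exact ENNReal.ofReal_le_ofReal (by linarith)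
  calc _ ≤ (ENNReal.ofReal (ε / 2)).toReal := ENNReal.toReal_mono (by simp) hle
    _ = ε / 2 := ENNReal.toReal_ofReal (by linarith)
    _ < ε := by linarith

/-- `ratio n` as a polynomial. -/
def ratioPoly (n : ℕ) : ℝ[X] := C (-((n : ℝ) + 1)⁻¹) * X + C (((n : ℝ) + 2) / (n + 1))

lemma eval_ratioPoly (n : ℕ) (x : ℝ) : (ratioPoly n).eval x = ratio n x := by
  simp only [ratioPoly, ratio, eval_add, eval_mul, eval_C, eval_X]
  field_simp
  ring

/-- Given `η 0 = x`, coordinate 1 is `ratio n x` times a coordinate of the smaller system, so its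
conditional m-th moment is a constant times `ratio n x ^ m`. -/
lemma correlation_polyLp_X_pow (n m : ℕ) :
    correlation n (polyLp (n + 1) (X ^ m)) =
      (∫ p, p 0 ^ m ∂(sigma (n + 1) 1)) • polyLp (n + 1) (ratioPoly n ^ m) := by
  refine ext_inner_left ℝ fun h => ?_
  rw [inner_correlation, inner_smul_right, inner_Lp]
  have hmp := measurePreserving_insertScaled (0 : Fin (n + 2))
  have hX := (measurePreserving_eval (1 : Fin (n + 2))).quasiMeasurePreserving.ae
    (coeFn_polyLp (n + 1) (X ^ m))
  have h1 : ∫ η, h (η 0) * (polyLp (n + 1) (X ^ m)) (η 1) ∂(sigma (n + 2) 1) =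
      ∫ η, h (η 0) * η 1 ^ m ∂(sigma (n + 2) 1) := by
    refine integral_congr_ae ?_
    filter_upwards [hX] with η hη
    rw [hη]; simp
  rw [h1, ← hmp.map_eq, integral_map hmp.measurable.aemeasurable]
  · have h2 : ∀ z : ℝ × (Fin (n + 1) → ℝ), h (insertScaled (0 : Fin (n + 2)) z 0) *
        insertScaled (0 : Fin (n + 2)) z 1 ^ m = (h z.1 * ratio n z.1 ^ m) * z.2 0 ^ m := by
      intro z
      have h3 : (1 : Fin (n + 2)) = (0 : Fin (n + 2)).succAbove 0 := by simp
      rw [insertScaled_same, h3, insertScaled_succAbove]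
      ring
    simp only [h2]
    rw [integral_prod_mul (fun x => h x * ratio n x ^ m) (fun p : Fin (n + 1) → ℝ => p 0 ^ m),
      mul_comm]
    congr 1
    refine integral_congr_ae ?_
    filter_upwards [coeFn_polyLp (n + 1) (ratioPoly n ^ m)] with x hx
    rw [hx]; simp [eval_ratioPoly]
  · exact (((Lp.stronglyMeasurable h).comp_measurable (measurable_pi_apply 0)).mul
      (measurable_pi_apply 1 |>.pow_const m).stronglyMeasurable).aestronglyMeasurable

lemma polyLp_mem_span {n m : ℕ} {p : ℝ[X]} (hp : p.degree < (m : WithBot ℕ)) :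
    polyLp n p ∈ Submodule.span ℝ ((fun j => polyLp n (X ^ j)) '' Set.Iio m) := by
  rw [← mem_degreeLT, degreeLT_eq_span_X_pow] at hp
  have := Submodule.mem_map_of_mem (f := polyLp n) hp
  rw [Submodule.map_span] at this
  refine Submodule.span_mono ?_ this
  rintro _ ⟨q, hq, rfl⟩
  simp only [Finset.coe_image, Set.mem_image, Finset.coe_range] at hq
  obtain ⟨j, hj, rfl⟩ := hq
  exact ⟨j, hj, rfl⟩

lemma degree_ratioPoly_pow_sub (n m : ℕ) :
    (ratioPoly n ^ m - C ((-((n : ℝ) + 1)⁻¹) ^ m) * X ^ m).degree < (m : WithBot ℕ) := by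
  have ha : -((n : ℝ) + 1)⁻¹ ≠ 0 := neg_ne_zero.2 (inv_ne_zero (by positivity))
  have hd : (ratioPoly n).degree = 1 := degree_linear ha
  have hl : (ratioPoly n).leadingCoeff = -((n : ℝ) + 1)⁻¹ := leadingCoeff_linear ha
  have hd1 : (ratioPoly n ^ m).degree = (m : WithBot ℕ) := by simp [degree_pow, hd]
  have hd2 : (C ((-((n : ℝ) + 1)⁻¹) ^ m) * X ^ m).degree = (m : WithBot ℕ) :=
    degree_C_mul_X_pow m (pow_ne_zero m ha)
  have := degree_sub_lt_left (hd1.trans hd2.symm)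
    (pow_ne_zero m (by intro h; rw [h] at hd; simp at hd)) (by simp [leadingCoeff_pow, hl])
  rwa [hd1] at this

lemma eigenvalue_le (n : ℕ) {m : ℕ} (hm : m ≠ 0) :
    (∫ p, p 0 ^ m ∂(sigma (n + 1) 1)) * (-((n : ℝ) + 1)⁻¹) ^ m ≤ 2 / ((n + 2) * (n + 1)) := by
  have hn : (0 : ℝ) < n + 1 := by positivity
  have hpos : ∀ᵐ p ∂(sigma (n + 1) 1), 0 ≤ p 0 / ((n : ℝ) + 1) ∧ p 0 / ((n : ℝ) + 1) ≤ 1 := by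
    filter_upwards [(measurePreserving_eval (0 : Fin (n + 1))).quasiMeasurePreserving.ae
      (ae_marginal n)] with p hp
    exact ⟨div_nonneg hp.1 hn.le, (div_le_one hn).2 hp.2⟩
  -- The entry for `m = 1` is negative. For `m ≥ 2` it is, up to sign, a moment of a variable in
  -- `[0, 1]`, hence at most the second moment, which equals the bound.
  obtain rfl | hm2 : m = 1 ∨ 2 ≤ m := by omega
  · refine le_trans ?_ (by positivity : (0 : ℝ) ≤ 2 / ((n + 2) * (n + 1)))
    simp only [pow_one]
    refine mul_nonpos_of_nonneg_of_nonpos (integral_nonneg_of_ae ?_)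
      (neg_nonpos.2 (by positivity))
    filter_upwards [hpos] with p hp
    have := mul_nonneg hp.1 hn.le
    rwa [div_mul_cancel₀ _ hn.ne'] at this
  · have h1 : (∫ p, p 0 ^ m ∂(sigma (n + 1) 1)) * (-((n : ℝ) + 1)⁻¹) ^ m =
        ∫ p, (-(p 0 / ((n : ℝ) + 1))) ^ m ∂(sigma (n + 1) 1) := by
      rw [← integral_mul_const]
      congr 1
      funext p
      rw [← mul_pow]
      congr 1
      ring
    have h2 : ∫ p, (p 0 / ((n : ℝ) + 1)) ^ 2 ∂(sigma (n + 1) 1) =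
        (2 : ℝ) / ((n + 2) * (n + 1)) := by
      simp only [div_pow]
      rw [integral_div, integral_sq]
      field_simp
    rw [h1, ← h2]
    refine integral_mono_ae (integrable_of_continuous (by fun_prop))
      (integrable_of_continuous (by fun_prop)) ?_
    filter_upwards [hpos] with p hp
    calc (-(p 0 / ((n : ℝ) + 1))) ^ m ≤ |(-(p 0 / ((n : ℝ) + 1))) ^ m| := le_abs_self _
      _ = (p 0 / ((n : ℝ) + 1)) ^ m := by rw [abs_pow, abs_neg, abs_of_nonneg hp.1]
      _ ≤ (p 0 / ((n : ℝ) + 1)) ^ 2 := pow_le_pow_of_le_one hp.1 hp.2 hm2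

lemma inner_polyLp_one (n : ℕ) : ⟪polyLp n 1, polyLp n 1⟫ = 1 := by
  have : (fun x => polyLp n 1 x * polyLp n 1 x) =ᵐ[marginal n] fun _ => 1 := by
    filter_upwards [coeFn_polyLp n 1] with x hx
    rw [hx]; simp
  rw [inner_Lp, integral_congr_ae this]
  simp

/-- The correlation operator is at most its second eigenvalue off the constants. -/
lemma inner_correlation_le (n : ℕ) (h : Lp ℝ 2 (marginal (n + 1)))
    (h0 : ⟪polyLp (n + 1) 1, h⟫ = 0) :
    ⟪h, correlation n h⟫ ≤ 2 / ((n + 2) * (n + 1)) * ‖h‖ ^ 2 := by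
  set c : ℝ := 2 / ((n + 2) * (n + 1)) with hc
  have hc0 : 0 ≤ c := by positivity
  set u := polyLp (n + 1) 1 with hu
  -- The rank-one term changes the eigenvalue of `c - K` at the constants from `c - 1` to 0, making
  -- `B` positive everywhere; it contributes nothing at `h`, which is orthogonal to the constants.
  set B : Lp ℝ 2 (marginal (n + 1)) →L[ℝ] Lp ℝ 2 (marginal (n + 1)) :=
    c • ContinuousLinearMap.id ℝ _ - correlation n +
      (1 - c) • (innerSL ℝ u).smulRight u with hB
  have hBapp : ∀ x, B x = c • x - correlation n x + (1 - c) • (⟪u, x⟫ • u) := by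
    intro x; simp [hB]
  have hpos := inner_nonneg_of_triangular B ?_ (fun j => polyLp (n + 1) (X ^ j)) ?_
    (fun m => if m = 0 then 0 else
      c - (∫ p, p 0 ^ m ∂(sigma (n + 1) 1)) * (-((n : ℝ) + 1)⁻¹) ^ m) ?_ ?_ h
  · rw [hBapp, inner_add_right, inner_sub_right, inner_smul_right, h0,
      real_inner_self_eq_norm_sq] at hpos
    simp at hpos
    linarith
  · intro x y
    simp only [hBapp, inner_add_left, inner_add_right, inner_sub_left, inner_sub_right,
      inner_smul_left, inner_smul_right, RCLike.conj_to_real, correlation_symm]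
    rw [real_inner_comm x u]
    ring
  · refine (dense_range_polyLp (n + 1)).mono ?_
    rintro _ ⟨p, rfl⟩
    rw [p.as_sum_range_C_mul_X_pow, map_sum]
    refine Submodule.sum_mem _ fun j _ => ?_
    rw [← smul_eq_C_mul, map_smul]
    exact Submodule.smul_mem _ _ (Submodule.subset_span ⟨j, rfl⟩)
  · intro m
    split_ifs with hm
    · exact le_rfl
    · exact sub_nonneg.2 (eigenvalue_le n hm)
  · intro m
    have hcor : correlation n (polyLp (n + 1) (X ^ m)) =
        ((∫ p, p 0 ^ m ∂(sigma (n + 1) 1)) * (-((n : ℝ) + 1)⁻¹) ^ m) • polyLp (n + 1) (X ^ m) +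
        (∫ p, p 0 ^ m ∂(sigma (n + 1) 1)) • polyLp (n + 1)
          (ratioPoly n ^ m - C ((-((n : ℝ) + 1)⁻¹) ^ m) * X ^ m) := by
      rw [correlation_polyLp_X_pow, map_sub, ← smul_eq_C_mul, map_smul, smul_sub, mul_smul]
      abel
    split_ifs with hm
    · subst hm
      have h1 : correlation n u = u := by
        have := correlation_polyLp_X_pow n 0
        simpa using this
      rw [pow_zero, ← hu, hBapp, h1, hu, inner_polyLp_one]
      have : c • polyLp (n + 1) 1 - polyLp (n + 1) 1 + (1 - c) • (1 : ℝ) • polyLp (n + 1) 1 -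
          (0 : ℝ) • polyLp (n + 1) 1 = 0 := by module
      rw [this]
      exact Submodule.zero_mem _
    · rw [hBapp, hcor]
      have hu2 : u ∈ Submodule.span ℝ ((fun j => polyLp (n + 1) (X ^ j)) '' Set.Iio m) :=
        Submodule.subset_span ⟨0, Nat.pos_of_ne_zero hm, by simp [hu]⟩
      have hv := polyLp_mem_span (n := n + 1) (degree_ratioPoly_pow_sub n m)
      have hmem := Submodule.sub_mem _ (Submodule.smul_mem _ ((1 - c) *
        ⟪u, polyLp (n + 1) (X ^ m)⟫) hu2) (Submodule.smul_mem _
        (∫ p, p 0 ^ m ∂(sigma (n + 1) 1)) hv)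
      convert hmem using 1
      module

end

/-! ### The conditional expectation given one coordinate -/

/-- The conditional mean of `f` given that the `k`-th energy is `x`. -/
def condMean {n : ℕ} (k : Fin (n + 2)) (f : (Fin (n + 2) → ℝ) → ℝ) (x : ℝ) : ℝ :=
  ∫ p, f (insertScaled k (x, p)) ∂(sigma (n + 1) 1)

section

variable {n : ℕ} {k : Fin (n + 2)} {f : (Fin (n + 2) → ℝ) → ℝ}

lemma stronglyMeasurable_comp_insertScaled (k : Fin (n + 2)) (hf : StronglyMeasurable f) :
    StronglyMeasurable fun z => f (insertScaled k z) :=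
  hf.comp_measurable (measurable_insertScaled k)

lemma stronglyMeasurable_condMean (k : Fin (n + 2)) (hf : StronglyMeasurable f) :
    StronglyMeasurable (condMean k f) :=
  (stronglyMeasurable_comp_insertScaled k hf).integral_prod_right

lemma integrable_comp_insertScaled (k : Fin (n + 2)) (hi : Integrable f (sigma (n + 2) 1)) :
    Integrable (fun z => f (insertScaled k z)) ((marginal (n + 1)).prod (sigma (n + 1) 1)) :=
  (measurePreserving_insertScaled k).integrable_comp_of_integrable hi

lemma integral_sigma_eq (k : Fin (n + 2)) (hf : StronglyMeasurable f)
    (hi : Integrable f (sigma (n + 2) 1)) :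
    ∫ η, f η ∂(sigma (n + 2) 1) = ∫ x, condMean k f x ∂(marginal (n + 1)) := by
  have hmp := measurePreserving_insertScaled k
  conv_lhs => rw [← hmp.map_eq]
  rw [integral_map hmp.measurable.aemeasurable hf.aestronglyMeasurable,
    integral_prod _ (integrable_comp_insertScaled k hi)]
  rfl

lemma condMean_mul (k : Fin (n + 2)) (u : ℝ → ℝ) (f : (Fin (n + 2) → ℝ) → ℝ) (x : ℝ) :
    condMean k (fun η => u (η k) * f η) x = u x * condMean k f x := by
  simp only [condMean, insertScaled_same, integral_const_mul]

lemma integral_eval_mul (hf : StronglyMeasurable f) {u : ℝ → ℝ} (hu : StronglyMeasurable u)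
    (hi : Integrable (fun η => u (η k) * f η) (sigma (n + 2) 1)) :
    ∫ η, u (η k) * f η ∂(sigma (n + 2) 1) = ∫ x, u x * condMean k f x ∂(marginal (n + 1)) := by
  have hm : StronglyMeasurable fun η => u (η k) * f η :=
    (hu.comp_measurable (measurable_pi_apply k)).mul hf
  rw [integral_sigma_eq k hm hi]
  simp only [condMean_mul]

lemma integral_comp_eval (k : Fin (n + 1)) {u : ℝ → ℝ} (hu : StronglyMeasurable u) :
    ∫ η, u (η k) ∂(sigma (n + 1) 1) = ∫ x, u x ∂(marginal n) := by
  rw [← (measurePreserving_eval k).map_eq, integral_map (measurable_pi_apply k).aemeasurable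
    hu.aestronglyMeasurable]

/-- The disintegration replaces the abstract conditional expectation by an integral over slices, a
version defined for every value of the coordinate. -/
lemma condProj_ae_eq (hf : StronglyMeasurable f) (hi : Integrable f (sigma (n + 2) 1)) :
    condProj (n + 2) k f =ᵐ[sigma (n + 2) 1] fun η => condMean k f (η k) := by
  have hle : MeasurableSpace.comap (fun η : Fin (n + 2) → ℝ => η k) inferInstance ≤
      MeasurableSpace.pi := (measurable_pi_apply k).comap_le
  have hg := stronglyMeasurable_condMean k hf
  have hgi : Integrable (fun η : Fin (n + 2) → ℝ => condMean k f (η k)) (sigma (n + 2) 1) :=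
    (measurePreserving_eval k).integrable_comp_of_integrable
      (integrable_comp_insertScaled k hi).integral_prod_left
  refine (ae_eq_condExp_of_forall_setIntegral_eq hle hi (fun s _ _ => hgi.integrableOn)
    ?_ ?_).symm
  · rintro s ⟨t, ht, rfl⟩ -
    have hu : StronglyMeasurable (t.indicator (1 : ℝ → ℝ)) :=
      (measurable_one.indicator ht).stronglyMeasurable
    have hind : ∀ F : (Fin (n + 2) → ℝ) → ℝ,
        ((fun η : Fin (n + 2) → ℝ => η k) ⁻¹' t).indicator F =
          fun η => t.indicator (1 : ℝ → ℝ) (η k) * F η := by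
      intro F
      funext η
      by_cases h : η k ∈ t
      · rw [Set.indicator_of_mem (by exact h), Set.indicator_of_mem h]; simp
      · rw [Set.indicator_of_notMem (by exact h), Set.indicator_of_notMem h]; simp
    have hm : MeasurableSet ((fun η : Fin (n + 2) → ℝ => η k) ⁻¹' t) := measurable_pi_apply k ht
    have hfi : Integrable (fun η => t.indicator (1 : ℝ → ℝ) (η k) * f η) (sigma (n + 2) 1) := by
      rw [← hind]; exact hi.indicator hm
    rw [← integral_indicator hm, ← integral_indicator hm, hind, hind,
      integral_eval_mul hf hu hfi]
    exact integral_comp_eval k (u := fun x => t.indicator (1 : ℝ → ℝ) x * condMean k f x)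
      (hu.mul hg)
  · exact (hg.comp_measurable (comap_measurable _)).aestronglyMeasurable

lemma memLp_condMean (k : Fin (n + 2)) (hf : StronglyMeasurable f)
    (h2 : MemLp f 2 (sigma (n + 2) 1)) : MemLp (condMean k f) 2 (marginal (n + 1)) := by
  have h1 : MemLp (condProj (n + 2) k f) 2 (sigma (n + 2) 1) := h2.condExp one_le_two
  have h3 := (memLp_congr_ae (condProj_ae_eq hf (h2.integrable one_le_two))).1 h1
  rw [← (measurePreserving_eval k).map_eq]
  exact (memLp_map_measure_iff (stronglyMeasurable_condMean k hf).aestronglyMeasurable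
    (measurable_pi_apply k).aemeasurable).2 h3

/-! ### The projections onto single coordinates are almost orthogonal -/

lemma sum_integral_condMean_sq_le (hf : StronglyMeasurable f) (h2 : MemLp f 2 (sigma (n + 2) 1))
    (h0 : ∫ η, f η ∂(sigma (n + 2) 1) = 0) :
    ∑ k, ∫ x, condMean k f x ^ 2 ∂(marginal (n + 1)) ≤
      (1 + 2 / ((n : ℝ) + 2)) * ∫ η, f η ^ 2 ∂(sigma (n + 2) 1) := by
  set F := h2.toLp f with hF
  set G : Fin (n + 2) → Lp ℝ 2 (marginal (n + 1)) :=
    fun k => (memLp_condMean k hf h2).toLp _ with hG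
  have hadj : ∀ k h, ⟪evalIsometry k h, F⟫ = ⟪h, G k⟫ := by
    intro k h
    have e1 : ⟪evalIsometry k h, F⟫ = ∫ η, h (η k) * f η ∂(sigma (n + 2) 1) := by
      rw [inner_Lp]
      refine integral_congr_ae ?_
      filter_upwards [coeFn_evalIsometry k h, h2.coeFn_toLp] with η a b
      rw [a, b]
    have hi : Integrable (fun η => h (η k) * f η) (sigma (n + 2) 1) :=
      ((Lp.memLp h).comp_measurePreserving (measurePreserving_eval k)).integrable_mul h2
    rw [e1, integral_eval_mul hf (Lp.stronglyMeasurable h) hi, inner_Lp]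
    refine integral_congr_ae ?_
    filter_upwards [(memLp_condMean k hf h2).coeFn_toLp] with x a
    rw [a]
  have hmean : ∀ k, ⟪polyLp (n + 1) 1, G k⟫ = 0 := by
    intro k
    rw [← hadj, inner_Lp, ← h0]
    refine integral_congr_ae ?_
    filter_upwards [coeFn_evalIsometry k (polyLp (n + 1) 1), h2.coeFn_toLp,
      (measurePreserving_eval k).quasiMeasurePreserving.ae (coeFn_polyLp (n + 1) 1)] with η a b c
    rw [a, b, c]; simp
  have hN : (((n + 2 : ℕ) : ℝ)) = (n : ℝ) + 2 := by push_cast; ring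
  have hbound := norm_sum_isometry_sq_le (N := n + 2) (by omega) evalIsometry (correlation n)
    (fun k l hkl => inner_evalIsometry_of_ne hkl) G (by
      have := inner_correlation_le n (∑ k, G k) (by
        rw [inner_sum]; exact Finset.sum_eq_zero fun k _ => hmean k)
      rw [hN]
      convert this using 3
      ring)
  rw [hN] at hbound
  have hS : ∑ k, ‖G k‖ ^ 2 = ⟪∑ k, evalIsometry k (G k), F⟫ := by
    rw [sum_inner]
    exact Finset.sum_congr rfl fun k _ => by rw [hadj, real_inner_self_eq_norm_sq]
  have hSG : ∑ k, ∫ x, condMean k f x ^ 2 ∂(marginal (n + 1)) = ∑ k, ‖G k‖ ^ 2 := by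
    refine Finset.sum_congr rfl fun k _ => ?_
    rw [← real_inner_self_eq_norm_sq, inner_Lp]
    refine integral_congr_ae ?_
    filter_upwards [(memLp_condMean k hf h2).coeFn_toLp] with x a
    rw [a, pow_two]
  have hFn : ∫ η, f η ^ 2 ∂(sigma (n + 2) 1) = ‖F‖ ^ 2 := by
    rw [← real_inner_self_eq_norm_sq, inner_Lp]
    refine integral_congr_ae ?_
    filter_upwards [h2.coeFn_toLp] with x a
    rw [a, pow_two]
  rw [hSG, hFn]
  set S := ∑ k, ‖G k‖ ^ 2 with hSdef
  have hS0 : 0 ≤ S := Finset.sum_nonneg fun k _ => sq_nonneg _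
  -- Cauchy–Schwarz applied to S = ⟪∑ A_k G_k, F⟫, followed by the bound on ‖∑ A_k G_k‖² in terms of
  -- S itself; one factor S then cancels.
  have hcs : S ^ 2 ≤ (1 + 2 / ((n : ℝ) + 2)) * S * ‖F‖ ^ 2 := by
    have h3 : S ≤ ‖∑ k, evalIsometry k (G k)‖ * ‖F‖ := hS ▸ real_inner_le_norm _ _
    calc S ^ 2 ≤ (‖∑ k, evalIsometry k (G k)‖ * ‖F‖) ^ 2 := pow_le_pow_left₀ hS0 h3 2
      _ = ‖∑ k, evalIsometry k (G k)‖ ^ 2 * ‖F‖ ^ 2 := mul_pow _ _ _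
      _ ≤ _ := mul_le_mul_of_nonneg_right hbound (sq_nonneg _)
  rcases hS0.eq_or_lt with h | h
  · rw [← h]; positivity
  · refine le_of_mul_le_mul_left ?_ h
    linarith [hcs]

/-! ### The form `𝒢` -/

lemma weight_one (n : ℕ) (x : ℝ) : weight 1 (n + 2) x = ratio n x := by
  rw [weight, Real.rpow_one, ratio]
  push_cast
  congr 1
  ring

lemma ae_ratio_mem (n : ℕ) : ∀ᵐ x ∂(marginal (n + 1)),
    0 ≤ ratio n x ∧ ratio n x ≤ ((n : ℝ) + 2) / (n + 1) := by
  filter_upwards [ae_marginal (n + 1)] with x hx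
  have hx2 : x ≤ n + 2 := by have := hx.2; push_cast at this; linarith
  exact ⟨div_nonneg (by linarith) (by positivity),
    div_le_div_of_nonneg_right (by linarith [hx.1]) (by positivity)⟩

lemma ae_ratio_eval_mem (k : Fin (n + 2)) : ∀ᵐ η ∂(sigma (n + 2) 1),
    0 ≤ ratio n (η k) ∧ ratio n (η k) ≤ ((n : ℝ) + 2) / (n + 1) :=
  (measurePreserving_eval k).quasiMeasurePreserving.ae (ae_ratio_mem n)

lemma integrable_ratio_mul (k : Fin (n + 2)) (hi : Integrable f (sigma (n + 2) 1)) :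
    Integrable (fun η => ratio n (η k) * f η) (sigma (n + 2) 1) := by
  refine hi.bdd_mul (c := ((n : ℝ) + 2) / (n + 1))
    ((measurable_ratio n).comp (measurable_pi_apply k)).aestronglyMeasurable ?_
  filter_upwards [ae_ratio_eval_mem k] with η h
  rw [Real.norm_eq_abs, abs_of_nonneg h.1]
  exact h.2

lemma sum_ratio_ae : ∀ᵐ η ∂(sigma (n + 2) 1), ∑ k, ratio n (η k) = (n : ℝ) + 2 := by
  filter_upwards [ae_mem_stateSpace (n + 1)] with η hη
  have h := hη.2
  push_cast at h
  simp only [ratio, ← Finset.sum_div, Finset.sum_sub_distrib, h, Finset.sum_const,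
    Finset.card_univ, Fintype.card_fin, nsmul_eq_mul]
  push_cast
  field_simp
  ring

lemma gForm_eq (hf : StronglyMeasurable f) (h2 : MemLp f 2 (sigma (n + 2) 1)) :
    gForm 1 (n + 2) f = 1 / ((n : ℝ) + 2) *
      ∑ k, ∫ η, ratio n (η k) * (f η - condMean k f (η k)) ^ 2 ∂(sigma (n + 2) 1) := by
  rw [gForm]
  push_cast
  congr 1
  refine Finset.sum_congr rfl fun k _ => integral_congr_ae ?_
  filter_upwards [condProj_ae_eq (k := k) hf (h2.integrable one_le_two)] with η h
  rw [weight_one, h]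

/-- The weight depends on `η k` only, so the cross term equals the weighted square of the
projection, as in Pythagoras. The weights sum to N in the `f ^ 2` terms and are bounded by N/(N-1)
in the projected ones. -/
lemma le_gForm (hf : StronglyMeasurable f) (h2 : MemLp f 2 (sigma (n + 2) 1))
    (h0 : ∫ η, f η ∂(sigma (n + 2) 1) = 0) :
    (1 - 1 / ((n : ℝ) + 1) - 2 / (((n : ℝ) + 2) * (n + 1))) * ∫ η, f η ^ 2 ∂(sigma (n + 2) 1) ≤
      gForm 1 (n + 2) f := by
  have hterm : ∀ k, ∫ η, ratio n (η k) * f η ^ 2 ∂(sigma (n + 2) 1) -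
      ((n : ℝ) + 2) / (n + 1) * ∫ x, condMean k f x ^ 2 ∂(marginal (n + 1)) ≤
      ∫ η, ratio n (η k) * (f η - condMean k f (η k)) ^ 2 ∂(sigma (n + 2) 1) := by
    intro k
    have hg := stronglyMeasurable_condMean k hf
    have hg2 := memLp_condMean k hf h2
    have hge := hg2.comp_measurePreserving (measurePreserving_eval k)
    have hgf : Integrable (fun η => condMean k f (η k) * f η) (sigma (n + 2) 1) :=
      hge.integrable_mul h2
    have hgg : Integrable (fun η : Fin (n + 2) → ℝ => condMean k f (η k) ^ 2) (sigma (n + 2) 1) :=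
      hge.integrable_sq
    have hcross : ∫ η, ratio n (η k) * (condMean k f (η k) * f η) ∂(sigma (n + 2) 1) =
        ∫ x, ratio n x * condMean k f x ^ 2 ∂(marginal (n + 1)) := by
      have := integral_eval_mul (k := k) (u := fun x => ratio n x * condMean k f x) hf
        ((measurable_ratio n).stronglyMeasurable.mul hg)
        (by simpa only [mul_assoc] using integrable_ratio_mul k hgf)
      simpa only [mul_assoc, ← pow_two] using this
    have hsq : ∫ η, ratio n (η k) * condMean k f (η k) ^ 2 ∂(sigma (n + 2) 1) =
        ∫ x, ratio n x * condMean k f x ^ 2 ∂(marginal (n + 1)) :=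
      integral_comp_eval k (u := fun x => ratio n x * condMean k f x ^ 2)
        ((measurable_ratio n).stronglyMeasurable.mul (hg.pow 2))
    have hexp : ∫ η, ratio n (η k) * (f η - condMean k f (η k)) ^ 2 ∂(sigma (n + 2) 1) =
        ∫ η, ratio n (η k) * f η ^ 2 ∂(sigma (n + 2) 1) -
          ∫ x, ratio n x * condMean k f x ^ 2 ∂(marginal (n + 1)) := by
      have h1 : ∀ η : Fin (n + 2) → ℝ, ratio n (η k) * (f η - condMean k f (η k)) ^ 2 =
          ratio n (η k) * f η ^ 2 - 2 * (ratio n (η k) * (condMean k f (η k) * f η)) +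
            ratio n (η k) * condMean k f (η k) ^ 2 := fun η => by ring
      have h3 : Integrable (fun η => ratio n (η k) * f η ^ 2 -
          2 * (ratio n (η k) * (condMean k f (η k) * f η))) (sigma (n + 2) 1) :=
        (integrable_ratio_mul k h2.integrable_sq).sub ((integrable_ratio_mul k hgf).const_mul 2)
      simp only [h1]
      rw [integral_add h3 (integrable_ratio_mul k hgg),
        integral_sub (integrable_ratio_mul k h2.integrable_sq)
        ((integrable_ratio_mul k hgf).const_mul 2), integral_const_mul, hcross, hsq]
      ring
    have hle : ∫ x, ratio n x * condMean k f x ^ 2 ∂(marginal (n + 1)) ≤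
        ((n : ℝ) + 2) / (n + 1) * ∫ x, condMean k f x ^ 2 ∂(marginal (n + 1)) := by
      rw [← integral_const_mul]
      refine integral_mono_of_nonneg ?_ (hg2.integrable_sq.const_mul _) ?_
      · filter_upwards [ae_ratio_mem n] with x hx using mul_nonneg hx.1 (sq_nonneg _)
      · filter_upwards [ae_ratio_mem n] with x hx using
          mul_le_mul_of_nonneg_right hx.2 (sq_nonneg _)
    rw [hexp]
    linarith
  have hsum : ∑ k, ∫ η, ratio n (η k) * f η ^ 2 ∂(sigma (n + 2) 1) =
      ((n : ℝ) + 2) * ∫ η, f η ^ 2 ∂(sigma (n + 2) 1) := by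
    rw [← integral_finsetSum _ fun k _ => integrable_ratio_mul k h2.integrable_sq,
      ← integral_const_mul]
    refine integral_congr_ae ?_
    filter_upwards [sum_ratio_ae (n := n)] with η h
    rw [← Finset.sum_mul, h]
  have hb := sum_integral_condMean_sq_le hf h2 h0
  have hs := Finset.sum_le_sum fun k (_ : k ∈ Finset.univ) => hterm k
  rw [Finset.sum_sub_distrib, hsum, ← Finset.mul_sum] at hs
  rw [gForm_eq hf h2, div_mul_eq_mul_div, one_mul, le_div_iff₀ (by positivity)]
  refine le_trans ?_ hs
  have hb2 := mul_le_mul_of_nonneg_left hb (by positivity : 0 ≤ ((n : ℝ) + 2) / (n + 1))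
  refine le_trans (le_of_eq ?_) (sub_le_sub_left hb2 _)
  field_simp
  ring

end

/-! ### The Dirichlet form -/

section

variable {n : ℕ} {f : (Fin (n + 1) → ℝ) → ℝ} {i j : Fin (n + 1)}

lemma exchangeAverage_eq (i j : Fin (n + 1)) (f : (Fin (n + 1) → ℝ) → ℝ)
    (η : Fin (n + 1) → ℝ) :
    exchangeAverage i j f η = ∫ α, f (exchange i j α η) ∂unitLaw :=
  intervalIntegral.integral_of_le zero_le_one

lemma stronglyMeasurable_exchangeAverage (i j : Fin (n + 1)) (hf : StronglyMeasurable f) :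
    StronglyMeasurable (exchangeAverage i j f) := by
  have h : StronglyMeasurable fun z : ℝ × (Fin (n + 1) → ℝ) => f (exchange i j z.1 z.2) :=
    hf.comp_measurable (measurable_exchange i j)
  have h2 : exchangeAverage i j f = fun η => ∫ α, f (exchange i j α η) ∂unitLaw :=
    funext (exchangeAverage_eq i j f)
  rw [h2]
  exact h.integral_prod_left

lemma integrable_mul_exchangeAverage (hij : i ≠ j) (h2 : MemLp f 2 (sigma (n + 1) 1)) :
    Integrable (fun η => f η * exchangeAverage i j f η) (sigma (n + 1) 1) := by
  have ha : MemLp (fun z : ℝ × (Fin (n + 1) → ℝ) => f (exchange i j z.1 z.2)) 2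
      (unitLaw.prod (sigma (n + 1) 1)) := h2.comp_measurePreserving (measurePreserving_exchange hij)
  have hb : MemLp (fun z : ℝ × (Fin (n + 1) → ℝ) => f z.2) 2
      (unitLaw.prod (sigma (n + 1) 1)) := h2.comp_measurePreserving measurePreserving_snd
  have hc : Integrable (fun z : ℝ × (Fin (n + 1) → ℝ) => f z.2 * f (exchange i j z.1 z.2))
      (unitLaw.prod (sigma (n + 1) 1)) := hb.integrable_mul ha
  refine hc.integral_prod_right.congr (Filter.Eventually.of_forall fun η => ?_)
  simp only [integral_const_mul, exchangeAverage_eq]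

lemma integrable_pair_mul {g : (Fin (n + 1) → ℝ) → ℝ} (i j : Fin (n + 1))
    (hg : Integrable g (sigma (n + 1) 1)) :
    Integrable (fun η => (η i + η j) * g η) (sigma (n + 1) 1) := by
  refine hg.bdd_mul (c := 2 * ((n : ℝ) + 1))
    (Continuous.aestronglyMeasurable (by fun_prop)) ?_
  filter_upwards [(measurePreserving_eval i).quasiMeasurePreserving.ae (ae_marginal n),
    (measurePreserving_eval j).quasiMeasurePreserving.ae (ae_marginal n)] with η hi hj
  rw [Real.norm_eq_abs, abs_of_nonneg (add_nonneg hi.1 hj.1)]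
  linarith [hi.2, hj.2]

/-- The contribution of one pair to the Dirichlet form with `γ = 1`. -/
def pairForm (i j : Fin (n + 1)) (f : (Fin (n + 1) → ℝ) → ℝ) : ℝ :=
  ∫ η, (η i + η j) * (f η * (f η - exchangeAverage i j f η)) ∂(sigma (n + 1) 1)

lemma integrable_mul_sub_exchangeAverage (hij : i ≠ j) (h2 : MemLp f 2 (sigma (n + 1) 1)) :
    Integrable (fun η => f η * (f η - exchangeAverage i j f η)) (sigma (n + 1) 1) := by
  have := h2.integrable_sq.sub (integrable_mul_exchangeAverage hij h2)
  refine this.congr (Filter.Eventually.of_forall fun η => ?_)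
  simp only [Pi.sub_apply]
  ring

/-- The sum of the pair contributions. -/
def pairSum (f : (Fin (n + 1) → ℝ) → ℝ) : ℝ :=
  ∑ i : Fin (n + 1), ∑ j : Fin (n + 1), if i < j then pairForm i j f else 0

lemma dirichletForm_eq (hn : n ≠ 0) (h2 : MemLp f 2 (sigma (n + 1) 1)) :
    dirichletForm 1 (n + 1) 1 f = 2 / (n : ℝ) * pairSum f := by
  have hcoef : (((n + 1 : ℕ) : ℝ) * (((n + 1).choose 2 : ℕ) : ℝ)⁻¹) = 2 / n := by
    rw [Nat.cast_choose_two]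
    have : (n : ℝ) ≠ 0 := by exact_mod_cast hn
    push_cast
    field_simp
    simpa using hn
  have hpt : ∀ η : Fin (n + 1) → ℝ, f η * generator 1 (n + 1) f η = -(2 / (n : ℝ)) *
      ∑ p ∈ (Finset.univ : Finset (Fin (n + 1) × Fin (n + 1))).filter (fun p => p.1 < p.2),
        (η p.1 + η p.2) * (f η * (f η - exchangeAverage p.1 p.2 f η)) := by
    intro η
    rw [generator, hcoef, mul_left_comm, Finset.mul_sum]
    congr 1
    refine Finset.sum_congr rfl fun p _ => ?_
    rw [Real.rpow_one]
    ring
  rw [dirichletForm]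
  simp only [hpt]
  rw [integral_const_mul, integral_finsetSum]
  · rw [neg_mul, neg_neg, pairSum, Finset.sum_filter, ← Finset.univ_product_univ,
      Finset.sum_product]
    rfl
  · intro p hp
    exact integrable_pair_mul _ _
      (integrable_mul_sub_exchangeAverage (Finset.mem_filter.1 hp).2.ne h2)

end

/-! ### Induction on the number of particles -/

lemma exchangeAverage_insertScaled {n : ℕ} (k : Fin (n + 2)) (i j : Fin (n + 1))
    (f : (Fin (n + 2) → ℝ) → ℝ) (x : ℝ) (p : Fin (n + 1) → ℝ) :
    exchangeAverage (k.succAbove i) (k.succAbove j) f (insertScaled k (x, p)) =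
      exchangeAverage i j (fun q => f (insertScaled k (x, q))) p := by
  simp only [exchangeAverage, exchange_insertScaled]

/-- On the slice the pair energy is `ratio n x` times that of the rescaled pair, so exactly one
factor of `ratio` comes out; this is where γ = 1 matters. -/
lemma pairForm_succAbove {n : ℕ} (k : Fin (n + 2)) {i j : Fin (n + 1)} (hij : i ≠ j)
    {f : (Fin (n + 2) → ℝ) → ℝ} (hf : StronglyMeasurable f) (h2 : MemLp f 2 (sigma (n + 2) 1)) :
    pairForm (k.succAbove i) (k.succAbove j) f =
        ∫ x, ratio n x * pairForm i j (fun q => f (insertScaled k (x, q))) ∂(marginal (n + 1)) ∧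
      Integrable (fun x => ratio n x * pairForm i j (fun q => f (insertScaled k (x, q))))
        (marginal (n + 1)) := by
  have hij' : k.succAbove i ≠ k.succAbove j := fun h => hij (Fin.succAbove_right_injective h)
  have hi := integrable_pair_mul (k.succAbove i) (k.succAbove j)
    (integrable_mul_sub_exchangeAverage hij' h2)
  have hm : StronglyMeasurable fun η : Fin (n + 2) → ℝ => (η (k.succAbove i) + η (k.succAbove j)) *
      (f η * (f η - exchangeAverage (k.succAbove i) (k.succAbove j) f η)) := by
    refine StronglyMeasurable.mul (Continuous.stronglyMeasurable (by fun_prop)) ?_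
    exact hf.mul (hf.sub (stronglyMeasurable_exchangeAverage _ _ hf))
  have hc : ∀ x, condMean k (fun η : Fin (n + 2) → ℝ => (η (k.succAbove i) + η (k.succAbove j)) *
      (f η * (f η - exchangeAverage (k.succAbove i) (k.succAbove j) f η))) x =
      ratio n x * pairForm i j (fun q => f (insertScaled k (x, q))) := by
    intro x
    simp only [condMean, pairForm, insertScaled_succAbove, exchangeAverage_insertScaled]
    rw [← integral_const_mul]
    congr 1
    funext p
    ring
  constructor
  · rw [pairForm, integral_sigma_eq k hm hi]
    simp only [hc]
  · refine (integrable_comp_insertScaled k hi).integral_prod_left.congr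
      (Filter.Eventually.of_forall hc)

lemma sum_succAbove_pairs {n : ℕ} (T : Fin (n + 2) → Fin (n + 2) → ℝ) :
    ∑ k : Fin (n + 2), ∑ i : Fin (n + 1), ∑ j : Fin (n + 1),
      (if i < j then T (k.succAbove i) (k.succAbove j) else 0) =
    n * ∑ i : Fin (n + 2), ∑ j : Fin (n + 2), if i < j then T i j else 0 := by
  have h1 : ∀ k : Fin (n + 2), ∑ i : Fin (n + 1), ∑ j : Fin (n + 1),
      (if i < j then T (k.succAbove i) (k.succAbove j) else 0) =
      ∑ i : Fin (n + 2), ∑ j : Fin (n + 2),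
        if i < j then (if k ≠ i ∧ k ≠ j then T i j else 0) else 0 := by
    intro k
    rw [Fin.sum_univ_succAbove _ k]
    simp only [ne_eq, not_true_eq_false, false_and, if_false, ite_self, Finset.sum_const_zero,
      zero_add]
    refine Finset.sum_congr rfl fun i _ => ?_
    rw [Fin.sum_univ_succAbove _ k]
    simp [Fin.succAbove_lt_succAbove_iff, (Fin.succAbove_ne _ _).symm]
  simp only [h1]
  rw [Finset.sum_comm, Finset.mul_sum]
  refine Finset.sum_congr rfl fun i _ => ?_
  rw [Finset.sum_comm, Finset.mul_sum]
  refine Finset.sum_congr rfl fun j _ => ?_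
  split_ifs with hij
  · rw [← Finset.sum_filter, Finset.sum_const, nsmul_eq_mul]
    congr 2
    -- A pair survives the removal of `k` for each of the `n` indices outside it.
    have : (Finset.univ.filter fun k : Fin (n + 2) => k ≠ i ∧ k ≠ j) = {i, j}ᶜ := by
      ext k; simp
    rw [this, Finset.card_compl, Finset.card_pair hij.ne, Fintype.card_fin]
    simp
  · simp

/-- A spectral gap `c` for `n + 1` particles. -/
def HasGap (n : ℕ) (c : ℝ) : Prop :=
  0 ≤ c ∧ ∀ f : (Fin (n + 1) → ℝ) → ℝ, StronglyMeasurable f → MemLp f 2 (sigma (n + 1) 1) →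
    c * ∫ η, (f η - ∫ ζ, f ζ ∂(sigma (n + 1) 1)) ^ 2 ∂(sigma (n + 1) 1) ≤
      dirichletForm 1 (n + 1) 1 f

lemma integral_ratio_mul_sub_condMean {n : ℕ} (k : Fin (n + 2)) {f : (Fin (n + 2) → ℝ) → ℝ}
    (hf : StronglyMeasurable f) (h2 : MemLp f 2 (sigma (n + 2) 1)) :
    ∫ η, ratio n (η k) * (f η - condMean k f (η k)) ^ 2 ∂(sigma (n + 2) 1) =
      ∫ x, ratio n x * ∫ p, (f (insertScaled k (x, p)) - condMean k f x) ^ 2 ∂(sigma (n + 1) 1)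
        ∂(marginal (n + 1)) := by
  have hge : MemLp (fun η : Fin (n + 2) → ℝ => condMean k f (η k)) 2 (sigma (n + 2) 1) :=
    (memLp_condMean k hf h2).comp_measurePreserving (measurePreserving_eval k)
  have hm : StronglyMeasurable fun η : Fin (n + 2) → ℝ => (f η - condMean k f (η k)) ^ 2 :=
    (hf.sub ((stronglyMeasurable_condMean k hf).comp_measurable (measurable_pi_apply k))).pow 2
  rw [integral_eval_mul hm (measurable_ratio n).stronglyMeasurable
    (integrable_ratio_mul k (h2.sub hge).integrable_sq)]
  simp only [condMean, insertScaled_same]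

lemma le_dirichletForm_of_hasGap {n : ℕ} (hn : n ≠ 0) {c : ℝ} (hc : HasGap n c)
    {f : (Fin (n + 2) → ℝ) → ℝ} (hf : StronglyMeasurable f) (h2 : MemLp f 2 (sigma (n + 2) 1)) :
    c * (((n : ℝ) + 2) / (n + 1)) * gForm 1 (n + 2) f ≤ dirichletForm 1 (n + 2) 1 f := by
  have hn0 : (0 : ℝ) < n := by exact_mod_cast Nat.pos_of_ne_zero hn
  have hk : ∀ k : Fin (n + 2), (n : ℝ) / 2 * c *
      ∫ η, ratio n (η k) * (f η - condMean k f (η k)) ^ 2 ∂(sigma (n + 2) 1) ≤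
      ∑ i : Fin (n + 1), ∑ j : Fin (n + 1),
        if i < j then pairForm (k.succAbove i) (k.succAbove j) f else 0 := by
    intro k
    have hsum : (∑ i : Fin (n + 1), ∑ j : Fin (n + 1),
        if i < j then pairForm (k.succAbove i) (k.succAbove j) f else 0) =
        ∫ x, ratio n x * pairSum (fun q => f (insertScaled k (x, q))) ∂(marginal (n + 1)) ∧
        Integrable (fun x => ratio n x * pairSum (fun q => f (insertScaled k (x, q))))
          (marginal (n + 1)) := by
      have hint : ∀ i j : Fin (n + 1), Integrable (fun x => if i < j then ratio n x *
          pairForm i j (fun q => f (insertScaled k (x, q))) else 0) (marginal (n + 1)) := by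
        intro i j
        split_ifs with hij
        · exact (pairForm_succAbove k hij.ne hf h2).2
        · exact integrable_zero _ _ _
      have hpt : ∀ x, ratio n x * pairSum (fun q => f (insertScaled k (x, q))) =
          ∑ i : Fin (n + 1), ∑ j : Fin (n + 1), if i < j then ratio n x *
          pairForm i j (fun q => f (insertScaled k (x, q))) else 0 := by
        intro x
        simp only [pairSum, Finset.mul_sum, mul_ite, mul_zero]
      simp only [hpt]
      refine ⟨?_, integrable_finsetSum _ fun i _ => integrable_finsetSum _ fun j _ => hint i j⟩
      rw [integral_finsetSum _ fun i _ => integrable_finsetSum _ fun j _ => hint i j]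
      refine Finset.sum_congr rfl fun i _ => ?_
      rw [integral_finsetSum _ fun j _ => hint i j]
      refine Finset.sum_congr rfl fun j _ => ?_
      split_ifs with hij
      · exact (pairForm_succAbove k hij.ne hf h2).1
      · simp
    rw [hsum.1, integral_ratio_mul_sub_condMean k hf h2, ← integral_const_mul]
    -- By Fubini almost every slice of `f` is square integrable, so the gap for the smaller system
    -- applies to it.
    have hmem : ∀ᵐ x ∂(marginal (n + 1)),
        MemLp (fun q => f (insertScaled k (x, q))) 2 (sigma (n + 1) 1) := by
      have h3 := (integrable_comp_insertScaled k h2.integrable_sq).prod_right_ae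
      filter_upwards [h3] with x hx
      refine (memLp_two_iff_integrable_sq ?_).2 hx
      exact ((stronglyMeasurable_comp_insertScaled k hf).comp_measurable
        measurable_prodMk_left).aestronglyMeasurable
    refine integral_mono_of_nonneg ?_ hsum.2 ?_
    · filter_upwards [ae_ratio_mem n] with x hx
      refine mul_nonneg (mul_nonneg (by positivity) hc.1) (mul_nonneg hx.1 ?_)
      exact integral_nonneg fun p => sq_nonneg _
    · filter_upwards [ae_ratio_mem n, hmem] with x hx hx2
      have h4 := hc.2 (fun q => f (insertScaled k (x, q))) ((stronglyMeasurable_comp_insertScaled k hf).comp_measurable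
        measurable_prodMk_left) hx2
      rw [dirichletForm_eq hn hx2, div_mul_eq_mul_div, le_div_iff₀ hn0] at h4
      have h5 := mul_le_mul_of_nonneg_left h4 hx.1
      simp only [condMean]
      linarith
  have hs := Finset.sum_le_sum fun k (_ : k ∈ Finset.univ) => hk k
  rw [sum_succAbove_pairs fun i j => pairForm i j f, ← Finset.mul_sum] at hs
  rw [dirichletForm_eq (Nat.succ_ne_zero n) h2, gForm_eq hf h2]
  push_cast
  change _ ≤ (n : ℝ) * pairSum f at hs
  set W := ∑ k, ∫ η, ratio n (η k) * (f η - condMean k f (η k)) ^ 2 ∂(sigma (n + 2) 1)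
  have hW : c / 2 * W ≤ pairSum f := by
    refine le_of_mul_le_mul_left ?_ hn0
    linarith
  refine le_trans (le_of_eq ?_) (mul_le_mul_of_nonneg_left hW
    (by positivity : (0 : ℝ) ≤ 2 / (n + 1)))
  field_simp

/-- Lets `le_gForm`, which requires mean zero, be applied to the centred function. -/
lemma gForm_sub_const {n : ℕ} {f : (Fin (n + 2) → ℝ) → ℝ} (h2 : MemLp f 2 (sigma (n + 2) 1))
    (a : ℝ) : gForm 1 (n + 2) (fun η => f η - a) = gForm 1 (n + 2) f := by
  rw [gForm, gForm]
  congr 1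
  refine Finset.sum_congr rfl fun k _ => integral_congr_ae ?_
  have hle : MeasurableSpace.comap (fun η : Fin (n + 2) → ℝ => η k) inferInstance ≤
      MeasurableSpace.pi := (measurable_pi_apply k).comap_le
  have h3 := condExp_sub (h2.integrable one_le_two) (integrable_const a)
    (MeasurableSpace.comap (fun η : Fin (n + 2) → ℝ => η k) inferInstance)
  rw [condExp_const hle] at h3
  filter_upwards [h3] with η h
  have h4 : condProj (n + 2) k (fun η => f η - a) η = condProj (n + 2) k f η - a := h
  rw [h4]
  ring

lemma HasGap.succ {n : ℕ} (hn : n ≠ 0) {c : ℝ} (hc : HasGap n c) :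
    HasGap (n + 1) (c * (1 - 3 / ((n : ℝ) + 1) ^ 2)) := by
  have hn1 : (1 : ℝ) ≤ n := by exact_mod_cast Nat.one_le_iff_ne_zero.2 hn
  refine ⟨mul_nonneg hc.1 ?_, fun f hf h2 => ?_⟩
  · rw [sub_nonneg, div_le_one (by positivity)]
    nlinarith
  · refine le_trans ?_ (le_dirichletForm_of_hasGap hn hc hf h2)
    set a := ∫ ζ, f ζ ∂(sigma (n + 2) 1) with ha
    have h0 : ∫ η, (f η - a) ∂(sigma (n + 2) 1) = 0 := by
      rw [integral_sub (h2.integrable one_le_two) (integrable_const a)]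
      simp [ha]
    have hle := le_gForm (f := fun η => f η - a) (hf.sub stronglyMeasurable_const)
      (h2.sub (memLp_const a)) h0
    rw [gForm_sub_const h2] at hle
    have hpos : 0 ≤ c * (((n : ℝ) + 2) / (n + 1)) := mul_nonneg hc.1 (by positivity)
    -- With N = n + 2, (N/(N-1)) (1 - 1/(N-1) - 2/(N(N-1))) = 1 - 3/(N-1)².
    refine le_trans (le_of_eq ?_) (mul_le_mul_of_nonneg_left hle hpos)
    rw [← mul_assoc]
    congr 1
    field_simp
    ring

/-- The pair energy is constantly 2, so the exchange average is the mean of `f`. The Dirichlet form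
is thus exactly 2 · 2 = 4 times the variance. -/
lemma hasGap_one : HasGap 1 4 := by
  refine ⟨by norm_num, fun f hf h2 => ?_⟩
  have hne : (0 : Fin 2) ≠ 1 := by simp
  set C := ∫ α, f (fun k => if k = 0 then α * 2 else (1 - α) * 2) ∂unitLaw with hC
  have hsupp : ∀ᵐ η ∂(sigma (1 + 1) 1), η 0 + η 1 = 2 := by
    filter_upwards [ae_mem_stateSpace 1] with η hη
    have := hη.2
    rw [Fin.sum_univ_two] at this
    rw [this]; norm_num
  have havg : ∀ᵐ η ∂(sigma (1 + 1) 1), exchangeAverage 0 1 f η = C := by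
    filter_upwards [hsupp] with η hη
    rw [exchangeAverage_eq, hC]
    congr 1
    funext α
    congr 1
    funext k
    fin_cases k <;> simp [exchange, hη]
  have hmean : ∫ η, f η ∂(sigma (1 + 1) 1) = C := by
    have hmp := measurePreserving_exchange hne
    have hi : Integrable (fun z : ℝ × (Fin 2 → ℝ) => f (exchange 0 1 z.1 z.2))
        (unitLaw.prod (sigma (1 + 1) 1)) :=
      hmp.integrable_comp_of_integrable (h2.integrable one_le_two)
    conv_lhs => rw [← hmp.map_eq]
    rw [integral_map hmp.measurable.aemeasurable hf.aestronglyMeasurable,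
      integral_prod_symm _ hi]
    have : (fun η => ∫ α, f (exchange 0 1 α η) ∂unitLaw) =ᵐ[sigma (1 + 1) 1] fun _ => C := by
      filter_upwards [havg] with η h
      rw [← exchangeAverage_eq, h]
    rw [integral_congr_ae this]
    simp
  have hpair : pairForm (0 : Fin 2) 1 f = 2 * ∫ η, (f η - C) ^ 2 ∂(sigma (1 + 1) 1) := by
    have h3 : pairForm (0 : Fin 2) 1 f =
        ∫ η, (2 * (f η - C) ^ 2 + 2 * C * (f η - C)) ∂(sigma (1 + 1) 1) := by
      refine integral_congr_ae ?_
      filter_upwards [hsupp, havg] with η a b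
      rw [a, b]
      ring
    have h4 : Integrable (fun η => f η - C) (sigma (1 + 1) 1) :=
      (h2.integrable one_le_two).sub (integrable_const C)
    have h5 : Integrable (fun η => (f η - C) ^ 2) (sigma (1 + 1) 1) :=
      (h2.sub (memLp_const C)).integrable_sq
    rw [h3, integral_add (h5.const_mul 2) (h4.const_mul (2 * C)), integral_const_mul,
      integral_const_mul, integral_sub (h2.integrable one_le_two) (integrable_const C), hmean]
    simp
  rw [dirichletForm_eq one_ne_zero h2, hmean]
  have : pairSum f = pairForm (0 : Fin 2) 1 f := by
    simp [pairSum, Fin.sum_univ_two]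
  rw [this, hpair]
  push_cast
  linarith

/-- `HasGap (m + 1)` concerns `m + 2` particles, so the shifted index `j + 3` runs over the particle
numbers from 3 to `m + 2`. -/
lemma hasGap_prod (m : ℕ) :
    HasGap (m + 1) (4 * ∏ j ∈ Finset.range m, (1 - 3 / (((j + 3 : ℕ) : ℝ) - 1) ^ 2)) := by
  induction m with
  | zero => simpa using hasGap_one
  | succ m ih =>
    have h := ih.succ (Nat.succ_ne_zero m)
    rw [Finset.prod_range_succ, ← mul_assoc]
    convert h using 5
    push_cast
    ring

/-! ### Trial functions -/

section

variable {n : ℕ} {f g : (Fin (n + 1) → ℝ) → ℝ}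

/-- A null set pulls back to a null set under the exchange; Fubini then makes the integrands agree
for almost every `α` at almost every `η`. This allows trial functions to be replaced by strongly
measurable versions. -/
lemma exchangeAverage_congr_ae {i j : Fin (n + 1)} (hij : i ≠ j) (h : f =ᵐ[sigma (n + 1) 1] g) :
    exchangeAverage i j f =ᵐ[sigma (n + 1) 1] exchangeAverage i j g := by
  have h1 := ((measurePreserving_exchange hij).comp
    (Measure.measurePreserving_swap (μ := sigma (n + 1) 1)
      (ν := unitLaw))).quasiMeasurePreserving.ae h
  filter_upwards [Measure.ae_ae_of_ae_prod h1] with η hη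
  rw [exchangeAverage_eq, exchangeAverage_eq]
  exact integral_congr_ae hη

lemma dirichletForm_congr_ae (γ : ℝ) (h : f =ᵐ[sigma (n + 1) 1] g) :
    dirichletForm γ (n + 1) 1 f = dirichletForm γ (n + 1) 1 g := by
  have h1 : ∀ᵐ η ∂(sigma (n + 1) 1), ∀ p : Fin (n + 1) × Fin (n + 1), p.1 < p.2 →
      exchangeAverage p.1 p.2 f η = exchangeAverage p.1 p.2 g η := by
    rw [ae_all_iff]
    intro p
    by_cases hp : p.1 < p.2
    · filter_upwards [exchangeAverage_congr_ae hp.ne h] with η hη _ using hη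
    · exact Filter.Eventually.of_forall fun η hp' => absurd hp' hp
  rw [dirichletForm, dirichletForm]
  congr 1
  refine integral_congr_ae ?_
  filter_upwards [h, h1] with η h2 h3
  rw [generator, generator, h2]
  congr 2
  refine Finset.sum_congr rfl fun p hp => ?_
  rw [h3 p (Finset.mem_filter.1 hp).2]

lemma gForm_congr_ae (γ : ℝ) (h : f =ᵐ[sigma (n + 1) 1] g) :
    gForm γ (n + 1) f = gForm γ (n + 1) g := by
  rw [gForm, gForm]
  congr 1
  refine Finset.sum_congr rfl fun k _ => integral_congr_ae ?_
  have h1 : condProj (n + 1) k f =ᵐ[sigma (n + 1) 1] condProj (n + 1) k g := condExp_congr_ae h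
  filter_upwards [h, h1] with η h2 h3
  rw [h2, h3]

lemma IsTrial.congr_ae (hf : IsTrial (n + 1) 1 f) (h : f =ᵐ[sigma (n + 1) 1] g) :
    IsTrial (n + 1) 1 g := by
  refine ⟨(memLp_congr_ae h).1 hf.1, ?_, ?_⟩
  · have h1 : (fun η => g η ^ 2) =ᵐ[sigma (n + 1) 1] fun η => f η ^ 2 := by
      filter_upwards [h] with η h2
      rw [h2]
    exact (integral_congr_ae h1).trans hf.2.1
  · rw [← hf.2.2]
    exact integral_congr_ae h.symm

end

/-- The infimum over an empty set of reals would be 0, so a trial function must be exhibited. The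
difference of two energies has second moment 2M - M = M, whence the normalization. -/
lemma exists_isTrial (n : ℕ) : ∃ f, IsTrial (n + 2) 1 f := by
  set M : ℝ := ∫ η, η 0 ^ 2 ∂(sigma (n + 1 + 1) 1) with hM
  have hMpos : 0 < M := by
    have := integral_sq (n + 1)
    rw [hM, this]
    positivity
  have h01 : (0 : Fin (n + 2)) ≠ 1 := by simp
  have hc : Continuous fun η : Fin (n + 2) → ℝ => (Real.sqrt M)⁻¹ * (η 0 - η 1) := by fun_prop
  refine ⟨fun η => (Real.sqrt M)⁻¹ * (η 0 - η 1), ?_, ?_, ?_⟩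
  · exact (memLp_two_iff_integrable_sq hc.aestronglyMeasurable).2
      (integrable_of_continuous (by fun_prop))
  · have h1 : ∀ η : Fin (n + 2) → ℝ, ((Real.sqrt M)⁻¹ * (η 0 - η 1)) ^ 2 =
        M⁻¹ * (η 0 ^ 2 + η 1 ^ 2 - 2 * (η 0 * η 1)) := by
      intro η
      rw [mul_pow, inv_pow, Real.sq_sqrt hMpos.le]
      ring
    simp only [h1]
    rw [integral_const_mul, integral_sub (integrable_of_continuous (by fun_prop))
      (integrable_of_continuous (by fun_prop)), integral_add
      (integrable_of_continuous (by fun_prop)) (integrable_of_continuous (by fun_prop)),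
      integral_const_mul, integral_mul_eq h01, integral_sq_eval 1, ← hM]
    field_simp
    ring
  · have h2 : ∫ η, η 1 ∂(sigma (n + 2) 1) = ∫ η, η 0 ∂(sigma (n + 2) 1) :=
      (integral_comp_eval (n := n + 1) 1 stronglyMeasurable_id).trans
        (integral_comp_eval (n := n + 1) 0 stronglyMeasurable_id).symm
    rw [integral_const_mul, integral_sub (integrable_of_continuous (by fun_prop))
      (integrable_of_continuous (by fun_prop)), h2, sub_self, mul_zero]

lemma le_Gamma (n : ℕ) :
    1 - 1 / ((n : ℝ) + 1) - 2 / (((n : ℝ) + 2) * (n + 1)) ≤ Gamma 1 (n + 2) := by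
  obtain ⟨f₀, hf₀⟩ := exists_isTrial n
  refine le_csInf ⟨_, f₀, hf₀, rfl⟩ ?_
  rintro _ ⟨f, hf, rfl⟩
  have hae := hf.1.1.ae_eq_mk
  have hg := hf.congr_ae hae
  rw [gForm_congr_ae 1 hae]
  have := le_gForm hf.1.1.stronglyMeasurable_mk hg.1 hg.2.2
  rwa [hg.2.1, mul_one] at this

lemma le_Delta_of_hasGap {n : ℕ} {c : ℝ} (hc : HasGap (n + 1) c) : c ≤ Delta 1 (n + 2) := by
  obtain ⟨f₀, hf₀⟩ := exists_isTrial n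
  refine le_csInf ⟨_, f₀, hf₀, rfl⟩ ?_
  rintro _ ⟨f, hf, rfl⟩
  have hae := hf.1.1.ae_eq_mk
  have hg := hf.congr_ae hae
  rw [dirichletForm_congr_ae 1 hae]
  have := hc.2 _ hf.1.1.stronglyMeasurable_mk hg.1
  simpa only [hg.2.2, sub_zero, hg.2.1, mul_one] using this

/-! ### The infinite product -/

lemma gapFactor_pos (j : ℕ) : 0 < 1 - 3 / (((j + 3 : ℕ) : ℝ) - 1) ^ 2 := by
  have hj : (0 : ℝ) ≤ j := Nat.cast_nonneg j
  push_cast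
  rw [sub_pos, div_lt_one (by nlinarith)]
  nlinarith

lemma gapFactor_le_one (j : ℕ) : 1 - 3 / (((j + 3 : ℕ) : ℝ) - 1) ^ 2 ≤ 1 :=
  sub_le_self _ (by positivity)

lemma summable_log_gapFactor :
    Summable fun j : ℕ => Real.log (1 - 3 / (((j + 3 : ℕ) : ℝ) - 1) ^ 2) := by
  have h : Summable fun j : ℕ => -(3 / (((j + 3 : ℕ) : ℝ) - 1) ^ 2) := by
    have h1 : Summable fun j : ℕ => 1 / ((j + 2 : ℕ) : ℝ) ^ 2 :=
      (summable_nat_add_iff 2).2 (Real.summable_one_div_nat_pow.2 one_lt_two)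
    refine (h1.mul_left (-3)).congr fun j => ?_
    push_cast
    ring
  simpa only [← sub_eq_add_neg] using Real.summable_log_one_add_of_summable h

lemma multipliable_gapFactor :
    Multipliable fun j : ℕ => 1 - 3 / (((j + 3 : ℕ) : ℝ) - 1) ^ 2 :=
  Real.multipliable_of_summable_log gapFactor_pos summable_log_gapFactor

lemma tprod_gapFactor_pos : 0 < ∏' j : ℕ, (1 - 3 / (((j + 3 : ℕ) : ℝ) - 1) ^ 2) := by
  rw [← Real.rexp_tsum_eq_tprod gapFactor_pos summable_log_gapFactor]
  exact Real.exp_pos _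

/-- All factors lie in `(0, 1]`, so the partial products decrease to their limit. -/
lemma tprod_gapFactor_le (m : ℕ) : ∏' j : ℕ, (1 - 3 / (((j + 3 : ℕ) : ℝ) - 1) ^ 2) ≤
    ∏ j ∈ Finset.range m, (1 - 3 / (((j + 3 : ℕ) : ℝ) - 1) ^ 2) := by
  refine Antitone.le_of_tendsto (antitone_nat_of_succ_le fun m => ?_)
    multipliable_gapFactor.hasProd.tendsto_prod_nat m
  rw [Finset.prod_range_succ]
  exact mul_le_of_le_one_right (Finset.prod_nonneg fun j _ => (gapFactor_pos j).le)
    (gapFactor_le_one m)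

end StochasticExchange
end

theorem theorem4p2 :
    (∀ N : ℕ, 3 ≤ N →
      0 < StochasticExchange.Gamma 1 N ∧
      1 - 1 / ((N : ℝ) - 1) - 2 / ((N : ℝ) * ((N : ℝ) - 1)) ≤ StochasticExchange.Gamma 1 N) ∧
    Multipliable (fun j : ℕ => 1 - 3 / (((j + 3 : ℕ) : ℝ) - 1) ^ 2) ∧
    0 < 4 * ∏' j : ℕ, (1 - 3 / (((j + 3 : ℕ) : ℝ) - 1) ^ 2) ∧
    (∀ N : ℕ, 3 ≤ N →
      4 * ∏' j : ℕ, (1 - 3 / (((j + 3 : ℕ) : ℝ) - 1) ^ 2) ≤ StochasticExchange.Delta 1 N) := by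
  refine ⟨fun N hN => ?_, StochasticExchange.multipliable_gapFactor,
    mul_pos four_pos StochasticExchange.tprod_gapFactor_pos, fun N hN => ?_⟩
  · obtain ⟨n, rfl⟩ := Nat.exists_eq_add_of_le' (show 2 ≤ N by omega)
    have hn : (1 : ℝ) ≤ n := by exact_mod_cast (show 1 ≤ n by omega)
    have hle := StochasticExchange.le_Gamma n
    -- The numerator is positive for `n ≥ 1`, that is N ≥ 3; at N = 2 the bound is negative.
    have hpos : 0 < 1 - 1 / ((n : ℝ) + 1) - 2 / (((n : ℝ) + 2) * (n + 1)) := by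
      have : 1 - 1 / ((n : ℝ) + 1) - 2 / (((n : ℝ) + 2) * (n + 1)) =
          (n ^ 2 + 2 * n - 2) / ((n + 2) * (n + 1)) := by
        field_simp
        ring
      rw [this]
      exact div_pos (by nlinarith) (by positivity)
    refine ⟨hpos.trans_le hle, le_trans (le_of_eq ?_) hle⟩
    push_cast
    ring
  · obtain ⟨n, rfl⟩ := Nat.exists_eq_add_of_le' (show 2 ≤ N by omega)
    exact (mul_le_mul_of_nonneg_left (StochasticExchange.tprod_gapFactor_le n) four_pos.le).trans
      (StochasticExchange.le_Delta_of_hasGap (StochasticExchange.hasGap_prod n))
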